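/- \textbf{Model.} The network is an $n$-vertex graph $G=(V,E)$, $n\ge 2$, whose vertices have distinct identity numbers from a range of size $n$ and know $n$ and the parameter $k$. Computation proceeds in synchronous rounds; in each round every vertex may send a message along each incident edge; messages are of unbounded size, local computation is free, and the vertices have independent private random coins. The running time is the number of rounds until all vertices have terminated. \textbf{Notions.} For a partition $Q$ of $V$ into clusters, the supergraph $\mathcal G(Q)$ is obtained by contracting every cluster. $Q$ is a strong $(d,\ell)$-network-decomposition if each cluster $C$ has diameter at most $d$ in the induced subgraph $G(C)$ and $\mathcal G(Q)$ is $\ell$-colorable. An $H$-partition of $\mathcal G(Q)$ of length $k$ and degree at most $A$ is a partition $(S_1,\dots,S_k)$ of its vertex set (empty parts are allowed) such that every $C\in S_i$ has at most $A$ neighbors in $S_i\cup\dots\cup S_k$. A $p$-labeling for $Q$ assigns to each vertex the color of its cluster in a proper $p$-coloring of $\mathcal G(Q)$. \textbf{Procedure Decompose} with parameter $k$ and a constant $\gamma$: put $q=n^{1/k}$, and start with $\hat G=G$ and $s=n$, at level $i=1$. If $s\le 2\gamma q\log n$, all supernodes of $\hat G$ form $S_i$, and the procedure stops. Otherwise each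 supernode of $\hat G$ joins a set $D$ independently with probability $1/q$; a supernode outside $D$ with a neighbor in $D$ joins the cluster of an arbitrary such neighbor; the supernodes neither in $D$ nor adjacent to $D$ form $S_i$; and the procedure continues at level $i+1$ on the supergraph obtained by contracting the clusters around the members of $D$, with $s/q$ in place of $s$. It stops at level at most $k$; the sets $S_i$ that it has not formed are empty, and its result is $Q=S_1\cup\dots\cup S_k$ together with $(S_1,\dots,S_k)$. \textbf{Theorem.} For all constants $c>0$ and $\gamma\ge 1$ there is a constant $C>0$ such that for all $n\ge 2$ and all $k\ge 1$ and every rule for the arbitrary choices the following holds. (1) Procedure Decompose can be carried out by a randomized distributed algorithm in at most $C\,3^k$ rounds. For every $n$-vertex graph $G$, with probability at least $1-n^{-c}$, its result is a strong $(3^{k-1}-1,\ C n^{1/k}\log n)$-network-decomposition $Q$ of $G$ together with an $H$-partition $(S_1,\dots,S_k)$ of length $k$ and degree at most $C n^{1/k}\log n$ of $\mathcal G(Q)$. (2) For every integer $t\ge 1$, this $Q$ and $(S_1,\dots,S_k)$ can be computed by a randomized distributed algorithm in at most $C\,3^k\,t$ rounds together with labels such that, for every $n$-vertex graph $G$, with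 probability at least $1-n^{-c}$, the properties in (1) hold and the labels form a $\bigl(C n^{2/k}\log^2 n\cdot\max\{1,\log^{(t)}n\}\bigr)$-labeling for $Q$. (Here $\log^{(t)}$ is the $t$-times iterated natural logarithm, and the maximum is read as $1$ if $\log^{(t)}n$ is undefined. In particular, $t=\log^* n$ gives time $O(3^k\log^* n)$ and $O(n^{2/k}\log^2 n)$ labels.) (3) This $Q$ and $(S_1,\dots,S_k)$ can be computed by a randomized distributed algorithm in at most $C\,3^k k^2$ rounds together with labels such that, for every $n$-vertex graph $G$, with probability at least $1-n^{-c}$, the properties in (1) hold and the labels form a $(C n^{2/k}\log n)$-labeling for $Q$. -/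

import Mathlib

open MeasureTheory
open scoped ENNReal

noncomputable section

/-! ### The synchronous message-passing model

The vertices of an `n`-vertex network are identified with their identity numbers, so the vertex
set is `Fin n` and a network is an arbitrary `SimpleGraph (Fin n)`. -/

/-- A randomized distributed algorithm for `n`-vertex networks, the same program at every vertex.
A vertex starts with its own identity number and its private random coins, which are drawn
from `law`.  In every round a vertex sends a message along each incident edge (`send s w` is the
message for the neighbor `w`) and updates its state from the messages that it
receives.  Messages are of unbounded size and local computation is free.  A vertex terminates as
soon as `output` of its state is `some o`, and `o` is its output. -/
structure DistAlg (n : ℕ) (Out : Type) where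
  Coin : Type
  [coinSpace : MeasurableSpace Coin]
  law : Measure Coin
  [isProb : IsProbabilityMeasure law]
  State : Type
  Msg : Type
  init : Fin n → Coin → State
  send : State → Fin n → Msg
  receive : State → (Fin n → Option Msg) → State
  output : State → Option Out

attribute [instance] DistAlg.coinSpace DistAlg.isProb

namespace DistAlg

variable {n : ℕ} {Out : Type}

open scoped Classical in
/-- The state of the vertex `v` after `t` rounds on the network `G`, with coins `ω`.  A vertex
that has terminated keeps its state and sends nothing. -/
def state (A : DistAlg n Out) (G : SimpleGraph (Fin n)) (ω : Fin n → A.Coin) :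
    ℕ → Fin n → A.State
  | 0, v => A.init v (ω v)
  | t + 1, v =>
      if A.output (A.state G ω t v) ≠ none then A.state G ω t v
      else A.receive (A.state G ω t v) fun u =>
        if G.Adj v u ∧ A.output (A.state G ω t u) = none then
          some (A.send (A.state G ω t u) v)
        else none

/-- After `T` rounds all vertices have terminated, and the output of each vertex `v` is `f v`. -/
def OutputsWithin (A : DistAlg n Out) (G : SimpleGraph (Fin n)) (ω : Fin n → A.Coin) (T : ℕ)
    (f : Fin n → Out) : Prop :=
  ∀ v, A.output (A.state G ω T v) = some (f v)

/-- The joint law of the coins: the vertices draw independently. -/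
def prob (A : DistAlg n Out) : Measure (Fin n → A.Coin) :=
  Measure.pi fun _ => A.law

end DistAlg

/-! ### Network decompositions, `H`-partitions and labelings -/

section Decompositions

variable {V : Type*}

/-- The supergraph obtained from `G` by contracting each cluster of the partition `Q`. -/
def supergraph (G : SimpleGraph V) (Q : Setoid V) : SimpleGraph (Quotient Q) where
  Adj C C' := C ≠ C' ∧ ∃ u w : V, (⟦u⟧ : Quotient Q) = C ∧ (⟦w⟧ : Quotient Q) = C' ∧ G.Adj u w
  symm := ⟨fun _ _ ⟨h, u, w, hu, hw, ha⟩ => ⟨h.symm, w, u, hw, hu, ha.symm⟩⟩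
  loopless := ⟨fun _ h => h.1 rfl⟩

/-- `Q` is a strong `(d, ℓ)`-network-decomposition of `G`: every cluster has diameter at most `d`
in the subgraph of `G` that it induces (so it is connected), and the supergraph
is `ℓ`-colorable. -/
def IsStrongNetworkDecomposition (G : SimpleGraph V) (Q : Setoid V) (d ℓ : ℕ) : Prop :=
  (∀ C : Quotient Q, (G.induce {v | (⟦v⟧ : Quotient Q) = C}).ediam ≤ (d : ℕ∞)) ∧
    (supergraph G Q).Colorable ℓ

/-- `(S 0, …, S (k - 1))` is an `H`-partition of `H` of length `k` and degree at most `A`. -/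
structure IsHPartition {W : Type*} (H : SimpleGraph W) {k : ℕ} (S : Fin k → Set W) (A : ℕ) :
    Prop where
  disjoint : ∀ i j, i ≠ j → Disjoint (S i) (S j)
  cover : ⋃ i, S i = Set.univ
  degree : ∀ i, ∀ C ∈ S i, {C' | H.Adj C C' ∧ ∃ j, i ≤ j ∧ C' ∈ S j}.encard ≤ (A : ℕ∞)

/-- `label` is a `p`-labeling for `Q`: it gives each vertex the color of its cluster in a proper
coloring of the supergraph with `p` colors. -/
def IsLabeling (G : SimpleGraph V) (Q : Setoid V) (p : ℕ) (label : V → ℕ) : Prop :=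
  ∃ φ : (supergraph G Q).Coloring (Fin p), ∀ v, label v = (φ ⟦v⟧ : ℕ)

end Decompositions

/-! ### Procedure Decompose -/

section Decompose

variable {n : ℕ}

/-- A rule by which a supernode `a` selects a member of a nonempty set `F` of candidates. -/
abbrev TieBreak (n : ℕ) : Type := Fin n → (F : Finset (Fin n)) → F.Nonempty → F

open scoped Classical in
/-- Procedure Partition on the supergraph `H`, a supernode being named by its leader.  Here
`join b` says that the supernode `b` joins the dominating set `D`.  The value
at `a` is the leader of the cluster that `a` joins: `a` itself if `a ∈ D`, else some neighbor of
`a` in `D`; it is `none` if there is no such neighbor, and then `a` belongs to the set `A`. -/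
def partitionLeader (pick : TieBreak n) (H : SimpleGraph (Fin n)) (join : Fin n → Bool)
    (a : Fin n) : Option (Fin n) :=
  if join a = true then some a
  else if h : (Finset.univ.filter fun b => H.Adj a b ∧ join b = true).Nonempty then
    some (pick a _ h).1
  else none

/-- The supergraph induced by the clusters that Procedure Partition has formed in `H`, each
cluster being named by its leader. -/
def contractClusters (H : SimpleGraph (Fin n)) (leader : Fin n → Option (Fin n)) :
    SimpleGraph (Fin n) where
  Adj b b' := b ≠ b' ∧ ∃ a a', leader a = some b ∧ leader a' = some b' ∧ H.Adj a a'
  symm := ⟨fun _ _ ⟨h, u, w, hu, hw, ha⟩ => ⟨h.symm, w, u, hw, hu, ha.symm⟩⟩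
  loopless := ⟨fun _ h => h.1 rfl⟩

/-- Recursion level `i` (counted from `0`) of Procedure Decompose on the supergraph `H`, with the
bound `s` on its number of supernodes, `q = n^(1/k)`, the termination
threshold `thr = 2 γ n^(1/k) log n`, and the coins of this and of the `m` levels that may follow.
The value at a supernode `a` of `H` is the leader of the final cluster that contains `a`, and the
index of the set `S_i` to which this cluster belongs.
At `m = 0` the last level is reached, where `s = n^(1/k) ≤ thr`. -/
def decomposeLevel (pick : TieBreak n) (q thr : ℝ) :
    (m : ℕ) → (coins : Fin m → Fin n → Bool) → (i : ℕ) → (s : ℝ) → (H : SimpleGraph (Fin n)) →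
      Fin n → Fin n × ℕ
  | 0, _, i, _, _, a => (a, i)
  | m + 1, coins, i, s, H, a =>
      if s ≤ thr then (a, i)
      else
        match partitionLeader pick H (coins 0) a with
        | none => (a, i)
        | some b =>
            decomposeLevel pick q thr m (fun j => coins j.succ) (i + 1) (s / q)
              (contractClusters H (partitionLeader pick H (coins 0))) b

/-- The coins of one vertex: one for each of the (at most `k - 1`) calls of Procedure Partition. -/
abbrev DecomposeCoin (k : ℕ) : Type := Fin (k - 1) → Bool

/-- The outcome of Procedure Decompose on `G` with parameter `k` and threshold constant `γ`:
every vertex gets the leader of its cluster and the index of the set `S_i` (counted from `0`)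
that contains its cluster.  The coins of a supernode are those of its leader. -/
def decompose (γ : ℝ) (k : ℕ) (pick : TieBreak n) (G : SimpleGraph (Fin n))
    (ω : Fin n → DecomposeCoin k) : Fin n → Fin n × ℕ :=
  decomposeLevel pick ((n : ℝ) ^ (1 / (k : ℝ))) (2 * γ * (n : ℝ) ^ (1 / (k : ℝ)) * Real.log n)
    (k - 1) (fun j v => ω v j) 0 n G

theorem inv_rpow_mem_unitInterval (n k : ℕ) :
    ((n : ℝ) ^ (1 / (k : ℝ)))⁻¹ ∈ unitInterval := by
  refine ⟨by positivity, ?_⟩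
  rcases Nat.eq_zero_or_pos n with rfl | hn
  · rcases Nat.eq_zero_or_pos k with rfl | hk
    · simp
    · have : (k : ℝ)⁻¹ ≠ 0 := by positivity
      simp [Real.zero_rpow this]
  · exact inv_le_one_of_one_le₀
      (Real.one_le_rpow (by exact_mod_cast hn) (by positivity))

/-- The law of the coins of one vertex: independent, each `true` with probability `1 / n^(1/k)`. -/
def decomposeLaw (n k : ℕ) : Measure (DecomposeCoin k) :=
  Measure.pi fun _ => ProbabilityTheory.bernoulliMeasure true false
    ⟨((n : ℝ) ^ (1 / (k : ℝ)))⁻¹, inv_rpow_mem_unitInterval n k⟩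

/-- The partition of the vertices into the clusters given by `out`. -/
def clusters (out : Fin n → Fin n × ℕ) : Setoid (Fin n) := Setoid.ker fun v => (out v).1

/-- The sets `S_i` of clusters given by `out`. -/
def clusterSets (k : ℕ) (out : Fin n → Fin n × ℕ) (i : Fin k) :
    Set (Quotient (clusters out)) :=
  {C | ∃ v, (⟦v⟧ : Quotient (clusters out)) = C ∧ (out v).2 = i}

/-- The clusters given by `out` form a strong `(3^(k-1) - 1, ⌊C n^(1/k) log n⌋)`-network-decomposition
`Q` of `G`, and the sets `S_i` form an `H`-partition of length `k` and degree at most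
`⌊C n^(1/k) log n⌋` of the supergraph of `Q`. -/
def IsGoodDecomposition (C : ℝ) (k : ℕ) (G : SimpleGraph (Fin n)) (out : Fin n → Fin n × ℕ) :
    Prop :=
  IsStrongNetworkDecomposition G (clusters out) (3 ^ (k - 1) - 1)
      ⌊C * (n : ℝ) ^ (1 / (k : ℝ)) * Real.log n⌋₊ ∧
    IsHPartition (supergraph G (clusters out)) (clusterSets k out)
      ⌊C * (n : ℝ) ^ (1 / (k : ℝ)) * Real.log n⌋₊

end Decompose

/-- The iterated logarithm `max {1, log^(t) n}` (for `t ≥ 1`): all iterates are cut off at `1`. -/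
def iterLog : ℕ → ℝ → ℝ
  | 0, x => x
  | t + 1, x => max 1 (Real.log (iterLog t x))

/-- Within `T` rounds and for all outcomes of the coins, `A` outputs the result
of Procedure Decompose together with labels; and with probability at least `1 - 1 / n^c`, that
result is a good decomposition with constant `C` and the labels form a `p`-labeling for it. -/
def ComputesWithLabels {n : ℕ} (A : DistAlg n ((Fin n × ℕ) × ℕ)) (T : ℕ) (c γ C : ℝ) (k p : ℕ)
    (pick : TieBreak n) : Prop :=
  ∃ π : A.Coin → DecomposeCoin k, MeasurePreserving π A.law (decomposeLaw n k) ∧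
    ∀ G : SimpleGraph (Fin n), ∃ label : (Fin n → A.Coin) → Fin n → ℕ,
      (∀ ω, A.OutputsWithin G ω T fun v =>
        (decompose γ k pick G (fun u => π (ω u)) v, label ω v)) ∧
      A.prob {ω | ¬ (IsGoodDecomposition C k G (decompose γ k pick G fun u => π (ω u)) ∧
        IsLabeling G (clusters (decompose γ k pick G fun u => π (ω u))) p (label ω))} ≤
          ENNReal.ofReal ((n : ℝ) ^ (-c))

/-- Within `T` rounds and for all outcomes of the coins, `A` outputs the result of Procedure
Decompose; and with probability at least `1 - 1 / n^c`, that result is a good decomposition with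
constant `C`. -/
def ComputesDecomposition {n : ℕ} (A : DistAlg n (Fin n × ℕ)) (T : ℕ) (c γ C : ℝ) (k : ℕ)
    (pick : TieBreak n) : Prop :=
  ∃ π : A.Coin → DecomposeCoin k, MeasurePreserving π A.law (decomposeLaw n k) ∧
    ∀ G : SimpleGraph (Fin n),
      (∀ ω, A.OutputsWithin G ω T (decompose γ k pick G fun u => π (ω u))) ∧
      A.prob {ω | ¬ IsGoodDecomposition C k G (decompose γ k pick G fun u => π (ω u))} ≤
        ENNReal.ofReal ((n : ℝ) ^ (-c))

end

/-!
Since messages are unbounded and local computation is free, a value that depends only on the graph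
and the coins up to distance `r` (`IsLocal`) is computed in `r + 1` rounds, by gathering all
information (`gatherAlg_outputsWithin`).  So for the running times it is enough to bound the
distance up to which a vertex has to look.

*Decomposition.*  `run` describes Procedure Decompose by the clusters present after each level.  A
cluster of the next level is a star of clusters, so the bound on the number of vertices of a
shortest path in a cluster triples at each level (`exists_walk_in_cluster`), and so does the
distance in question (`isLocal_run`).  The `H`-partition and the coloring follow from a bound on the
number of `laterNbrs`, the adjacent clusters that are not in an earlier set `S_i`.  For a cluster
that is finished at level `j` this number is at most its degree in the supergraph of
level `j`, because contraction only identifies neighbors.  If this degree is large, then it is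
unlikely that neither the supernode nor any neighbor has joined the dominating set
(`measure_undominated_le`; the supergraph is independent of the coins of its own level).  The union
bound over the levels costs no factor `k`, because the supernode itself has not joined either, which
has probability at most `log n / k`.  A cluster that is left at the end has only the other
remaining supernodes as neighbors; these are the vertices that have joined at every level, and their
number is binomial with mean at most the termination threshold (`measure_survivors_le`).

*Labels.*  Each leader draws additional random colors.  Let `A` be the bound on the number of later
neighbors.  For the second part, a leader draws `O(log n)` colors out of `O(A)`, and uses the first
position at which its color differs from those of all its later neighbors; with the position as
a part of the label, this gives a proper coloring.  One exchange with the adjacent clusters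
suffices, and the number of labels is `O(A log n)`, which is below the required bound for every `t`.
For the third part, the sets `S_i` are colored in descending order with a palette of
`A n^(1/k)` colors.  Each set has `O(k)` trials, and in a trial an uncolored cluster keeps its
random color unless a later neighbor has or tries it.  This fails with probability at most
`n^(-1/k)`, so `O(k)` trials suffice, in total `O(k ^ 2)` exchanges of `O(3 ^ k)` rounds
each.  In both cases the colors forbidden to a leader at some trial depend only on the coins of the
others and on its own earlier trials, so failures are counted by `ncard_forall_mem_le`.
-/

noncomputable section

/-! ### Local functions and their computation by gathering -/

section Local

variable {n : ℕ} {Coin Coin' X : Type*}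

/-- The networks `G`, `G'` with coins `ω`, `ω'` look the same from `v` up to distance `r`: the
vertices within distance `r` of `v` in `G` have the same coins and the same neighbors in both. -/
def AgreeAt (r : ℕ) (G G' : SimpleGraph (Fin n)) (ω ω' : Fin n → Coin) (v : Fin n) : Prop :=
  ∀ u (p : G.Walk v u), p.length ≤ r → ω u = ω' u ∧ ∀ w, G.Adj u w ↔ G'.Adj u w

theorem AgreeAt.mono {r s : ℕ} (h : s ≤ r) {G G' : SimpleGraph (Fin n)} {ω ω' : Fin n → Coin}
    {v : Fin n} (ha : AgreeAt r G G' ω ω' v) : AgreeAt s G G' ω ω' v :=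
  fun u p hp => ha u p (hp.trans h)

theorem AgreeAt.move {r s : ℕ} {G G' : SimpleGraph (Fin n)} {ω ω' : Fin n → Coin}
    {v u : Fin n} (ha : AgreeAt r G G' ω ω' v) (p : G.Walk v u) (hp : p.length + s ≤ r) :
    AgreeAt s G G' ω ω' u :=
  fun w p' hp' => ha w (p.append p') (by rw [SimpleGraph.Walk.length_append]; omega)

theorem AgreeAt.coin_eq {r : ℕ} {G G' : SimpleGraph (Fin n)} {ω ω' : Fin n → Coin}
    {v : Fin n} (ha : AgreeAt r G G' ω ω' v) : ω v = ω' v :=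
  (ha v .nil (Nat.zero_le _)).1

theorem AgreeAt.adj_iff {r : ℕ} {G G' : SimpleGraph (Fin n)} {ω ω' : Fin n → Coin}
    {v : Fin n} (ha : AgreeAt r G G' ω ω' v) (w : Fin n) : G.Adj v w ↔ G'.Adj v w :=
  (ha v .nil (Nat.zero_le _)).2 w

/-- A short walk of `G'` is also a walk of `G`. -/
theorem AgreeAt.exists_walk {G G' : SimpleGraph (Fin n)} {ω ω' : Fin n → Coin}
    {v u : Fin n} (p : G'.Walk v u) :
    ∀ {r : ℕ}, AgreeAt r G G' ω ω' v → p.length ≤ r → ∃ p' : G.Walk v u, p'.length = p.length := by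
  induction p with
  | nil => exact fun _ _ => ⟨.nil, rfl⟩
  | @cons v x u hvx p ih =>
    intro r ha hr
    rw [SimpleGraph.Walk.length_cons] at hr
    have hvx' : G.Adj v x := (ha.adj_iff x).2 hvx
    obtain ⟨p', hp'⟩ := ih (r := p.length)
      (ha.move (.cons hvx' .nil) (by simp; omega)) le_rfl
    exact ⟨.cons hvx' p', by simp [hp']⟩

theorem AgreeAt.symm {r : ℕ} {G G' : SimpleGraph (Fin n)} {ω ω' : Fin n → Coin}
    {v : Fin n} (ha : AgreeAt r G G' ω ω' v) : AgreeAt r G' G ω' ω v := by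
  intro u p hp
  obtain ⟨p', hp'⟩ := AgreeAt.exists_walk p ha hp
  obtain ⟨h₁, h₂⟩ := ha u p' (by omega)
  exact ⟨h₁.symm, fun w => (h₂ w).symm⟩

/-- `F` assigns to every network with coins a value at each vertex, and this value depends only on
what the vertex sees up to distance `r`. -/
def IsLocal (r : ℕ) (F : SimpleGraph (Fin n) → (Fin n → Coin) → Fin n → X) : Prop :=
  ∀ G G' ω ω' v, AgreeAt r G G' ω ω' v → F G ω v = F G' ω' v

theorem IsLocal.mono {r s : ℕ} (h : r ≤ s)
    {F : SimpleGraph (Fin n) → (Fin n → Coin) → Fin n → X} (hF : IsLocal r F) : IsLocal s F :=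
  fun _ _ _ _ v ha => hF _ _ _ _ v (ha.mono h)

theorem IsLocal.comap {r : ℕ} (π : Coin' → Coin)
    {F : SimpleGraph (Fin n) → (Fin n → Coin) → Fin n → X} (hF : IsLocal r F) :
    IsLocal r fun G (ω : Fin n → Coin') v => F G (fun u => π (ω u)) v :=
  fun _ _ _ _ v ha => hF _ _ _ _ v fun u p hp =>
    ⟨congrArg π (ha u p hp).1, (ha u p hp).2⟩

/-- The value at the vertex `ℓ v`, where `ℓ v` is found within distance `d` of `v`. -/
theorem IsLocal.eval {r s d t : ℕ} {ℓ : SimpleGraph (Fin n) → (Fin n → Coin) → Fin n → Fin n}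
    {F : SimpleGraph (Fin n) → (Fin n → Coin) → Fin n → X} (hℓ : IsLocal r ℓ) (hF : IsLocal s F)
    (hd : ∀ (G : SimpleGraph (Fin n)) ω v, ∃ p : G.Walk v (ℓ G ω v), p.length ≤ d)
    (hr : r ≤ t) (hs : d + s ≤ t) :
    IsLocal t fun G ω v => F G ω (ℓ G ω v) := by
  intro G G' ω ω' v ha
  obtain ⟨p, hp⟩ := hd G ω v
  have h := hℓ G G' ω ω' v (ha.mono hr)
  simp only [← h]
  exact hF _ _ _ _ _ (ha.move p (by omega))

/-- The pairs of values at the two ends of the edges that leave the vertices with leader `a`; every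
vertex is within distance `d` of its leader. -/
theorem IsLocal.boundary {r d t : ℕ} {ℓ : SimpleGraph (Fin n) → (Fin n → Coin) → Fin n → Fin n}
    {F : SimpleGraph (Fin n) → (Fin n → Coin) → Fin n → X} (hℓ : IsLocal r ℓ) (hF : IsLocal r F)
    (hd : ∀ (G : SimpleGraph (Fin n)) ω v, ∃ p : G.Walk v (ℓ G ω v), p.length ≤ d)
    (ht : d + 1 + r ≤ t) :
    IsLocal t fun G ω a => {y : X × X | ∃ u w, ℓ G ω u = a ∧ G.Adj u w ∧
      y = (F G ω u, F G ω w)} := by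
  have key : ∀ G G' ω ω' a, AgreeAt t G G' ω ω' a → ∀ y : X × X,
      (∃ u w, ℓ G ω u = a ∧ G.Adj u w ∧ y = (F G ω u, F G ω w)) →
      ∃ u w, ℓ G' ω' u = a ∧ G'.Adj u w ∧ y = (F G' ω' u, F G' ω' w) := by
    rintro G G' ω ω' a ha y ⟨u, w, hu, hadj, rfl⟩
    obtain ⟨p, hp⟩ : ∃ p : G.Walk u a, p.length ≤ d := hu ▸ hd G ω u
    have hau : AgreeAt (r + 1) G G' ω ω' u :=
      ha.move p.reverse (by rw [SimpleGraph.Walk.length_reverse]; omega)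
    have haw : AgreeAt r G G' ω ω' w := hau.move (.cons hadj .nil) (by simp; omega)
    have hau' := hau.mono (Nat.le_succ r)
    refine ⟨u, w, ?_, (hau.adj_iff w).1 hadj, ?_⟩
    · rw [← hℓ _ _ _ _ u hau', hu]
    · rw [hF _ _ _ _ u hau', hF _ _ _ _ w haw]
  intro G G' ω ω' a ha
  ext y
  exact ⟨key _ _ _ _ a ha y, key _ _ _ _ a ha.symm y⟩

end Local

section Gather

variable {n : ℕ} {Coin Out : Type}

/-- What the vertex `v` knows after `t` rounds in which all vertices forward all their knowledge,
encoded as the set of the networks with coins that are consistent with it. -/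
def knowledge (G : SimpleGraph (Fin n)) (ω : Fin n → Coin) :
    ℕ → Fin n → Set (SimpleGraph (Fin n) × (Fin n → Coin))
  | 0, v => {x | x.2 v = ω v}
  | t + 1, v => {x | x ∈ knowledge G ω t v ∧
      ∀ u, (x.1.Adj v u ↔ G.Adj v u) ∧ (G.Adj v u → x ∈ knowledge G ω t u)}

theorem mem_knowledge (G : SimpleGraph (Fin n)) (ω : Fin n → Coin) (t : ℕ) (v : Fin n) :
    (G, ω) ∈ knowledge G ω t v := by
  induction t generalizing v with
  | zero => rfl
  | succ t ih => exact ⟨ih v, fun u => ⟨Iff.rfl, fun _ => ih u⟩⟩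

theorem coin_eq_of_mem_knowledge {G : SimpleGraph (Fin n)} {ω : Fin n → Coin} {t : ℕ} {v : Fin n}
    {x : SimpleGraph (Fin n) × (Fin n → Coin)} (hx : x ∈ knowledge G ω t v) : x.2 v = ω v := by
  induction t with
  | zero => exact hx
  | succ t ih => exact ih hx.1

theorem agreeAt_of_mem_knowledge {G : SimpleGraph (Fin n)} {ω : Fin n → Coin} {t : ℕ} {v : Fin n}
    {x : SimpleGraph (Fin n) × (Fin n → Coin)} (hx : x ∈ knowledge G ω (t + 1) v) :
    AgreeAt t G x.1 ω x.2 v := by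
  intro u p hp
  induction p generalizing t with
  | nil => exact ⟨(coin_eq_of_mem_knowledge hx).symm, fun w => (hx.2 w).1.symm⟩
  | cons h p ih =>
    rw [SimpleGraph.Walk.length_cons] at hp
    obtain ⟨t, rfl⟩ : ∃ t', t = t' + 1 := ⟨t - 1, by omega⟩
    exact ih ((hx.2 _).2 h) (by omega)

open scoped Classical in
/-- The algorithm that gathers information for `T` rounds and then evaluates `F` on some network
with coins that is consistent with it.  A state is the number of the round, the identity number
and the knowledge of the vertex; a message is the knowledge of its sender. -/
def gatherAlg [MeasurableSpace Coin] (law : Measure Coin) [IsProbabilityMeasure law] (T : ℕ)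
    (F : SimpleGraph (Fin n) → (Fin n → Coin) → Fin n → Out) : DistAlg n Out where
  Coin := Coin
  law := law
  State := ℕ × Fin n × Set (SimpleGraph (Fin n) × (Fin n → Coin))
  Msg := Set (SimpleGraph (Fin n) × (Fin n → Coin))
  init v x := (0, v, {y | y.2 v = x})
  send s _ := s.2.2
  receive s msgs := (s.1 + 1, s.2.1, {x | x ∈ s.2.2 ∧
    ∀ u, (x.1.Adj s.2.1 u ↔ msgs u ≠ none) ∧ ∀ m, msgs u = some m → x ∈ m})
  output s := if h : s.1 = T ∧ s.2.2.Nonempty then some (F h.2.some.1 h.2.some.2 s.2.1) else none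

open scoped Classical in
theorem DistAlg.state_succ_of_output_eq_none (A : DistAlg n Out) (G : SimpleGraph (Fin n))
    (ω : Fin n → A.Coin) (t : ℕ) (h : ∀ u, A.output (A.state G ω t u) = none) (v : Fin n) :
    A.state G ω (t + 1) v = A.receive (A.state G ω t v) fun u =>
      if G.Adj v u then some (A.send (A.state G ω t u) v) else none := by
  rw [DistAlg.state]
  simp only [h, ne_eq, not_true_eq_false, if_false, and_true]

theorem gatherAlg_output_eq_none [MeasurableSpace Coin] (law : Measure Coin)
    [IsProbabilityMeasure law] (T : ℕ) (F : SimpleGraph (Fin n) → (Fin n → Coin) → Fin n → Out)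
    (s : ℕ × Fin n × Set (SimpleGraph (Fin n) × (Fin n → Coin))) (hs : s.1 ≠ T) :
    (gatherAlg law T F).output s = none :=
  dif_neg fun h => hs h.1

theorem gatherAlg_state [MeasurableSpace Coin] (law : Measure Coin) [IsProbabilityMeasure law]
    (T : ℕ) (F : SimpleGraph (Fin n) → (Fin n → Coin) → Fin n → Out) (G : SimpleGraph (Fin n))
    (ω : Fin n → Coin) (t : ℕ) (ht : t ≤ T) (v : Fin n) :
    (gatherAlg law T F).state G ω t v = (t, v, knowledge G ω t v) := by
  classical
  induction t generalizing v with
  | zero => rfl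
  | succ t ih =>
    have ih' := fun v => ih (by omega) v
    have hnone : ∀ v, (gatherAlg law T F).output ((gatherAlg law T F).state G ω t v) = none := by
      intro v
      rw [ih']
      exact gatherAlg_output_eq_none law T F _ (by change t ≠ T; omega)
    refine ((gatherAlg law T F).state_succ_of_output_eq_none G ω t hnone v).trans ?_
    let msgs : Fin n → Option (Set (SimpleGraph (Fin n) × (Fin n → Coin))) :=
      fun u => if G.Adj v u then some (knowledge G ω t u) else none
    have hmsgs : (fun u => if G.Adj v u then some ((gatherAlg law T F).send
        ((gatherAlg law T F).state G ω t u) v) else none) = msgs := by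
      funext u
      rw [ih']
      rfl
    rw [ih']
    refine (congrArg ((gatherAlg law T F).receive (t, v, knowledge G ω t v)) hmsgs).trans ?_
    refine Prod.ext rfl (Prod.ext rfl (Set.ext fun x => and_congr_right fun _ =>
      forall_congr' fun u => ?_))
    change ((x.1.Adj v u ↔ msgs u ≠ none) ∧ ∀ m, msgs u = some m → x ∈ m) ↔ _
    by_cases h : G.Adj v u <;> simp [msgs, h]

/-- An `r`-local function is computed in `r + 1` rounds; the last round tells the vertices
at distance `r` their neighbors. -/
theorem gatherAlg_outputsWithin [MeasurableSpace Coin] (law : Measure Coin)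
    [IsProbabilityMeasure law] {r : ℕ} {F : SimpleGraph (Fin n) → (Fin n → Coin) → Fin n → Out}
    (hF : IsLocal r F) (G : SimpleGraph (Fin n)) (ω : Fin n → Coin) :
    (gatherAlg law (r + 1) F).OutputsWithin G ω (r + 1) (F G ω) := by
  intro v
  rw [gatherAlg_state law (r + 1) F G ω (r + 1) le_rfl v]
  have hne : (knowledge G ω (r + 1) v).Nonempty := ⟨_, mem_knowledge G ω (r + 1) v⟩
  have hout : (gatherAlg law (r + 1) F).output (r + 1, v, knowledge G ω (r + 1) v) =
      some (F hne.some.1 hne.some.2 v) := dif_pos ⟨rfl, hne⟩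
  exact hout.trans
    (congrArg some (hF _ _ _ _ v (agreeAt_of_mem_knowledge hne.some_mem)).symm)

end Gather

/-! ### Procedure Decompose, one level after the other -/

section Run

variable {n : ℕ}

theorem partitionLeader_eq_some {pick : TieBreak n} {H : SimpleGraph (Fin n)} {join : Fin n → Bool}
    {a b : Fin n} (h : partitionLeader pick H join a = some b) :
    join b = true ∧ (a = b ∨ H.Adj a b) := by
  unfold partitionLeader at h
  split_ifs at h with h₁ h₂
  · cases h
    exact ⟨h₁, Or.inl rfl⟩
  · have h' : (pick a _ h₂).1 = b := Option.some.inj h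
    have hm := (pick a _ h₂).2
    rw [h'] at hm
    simp only [Finset.mem_filter, Finset.mem_univ, true_and] at hm
    exact ⟨hm.2, Or.inr hm.1⟩

theorem partitionLeader_of_join {pick : TieBreak n} {H : SimpleGraph (Fin n)} {join : Fin n → Bool}
    {a : Fin n} (h : join a = true) : partitionLeader pick H join a = some a :=
  if_pos h

theorem partitionLeader_eq_none {pick : TieBreak n} {H : SimpleGraph (Fin n)} {join : Fin n → Bool}
    {a : Fin n} (h : partitionLeader pick H join a = none) :
    join a = false ∧ ∀ b, H.Adj a b → join b = false := by
  unfold partitionLeader at h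
  split_ifs at h with h₁ h₂
  refine ⟨by simpa using h₁, fun b hb => ?_⟩
  by_contra hj
  exact h₂ ⟨b, by simpa [hb] using hj⟩

theorem partitionLeader_congr {pick : TieBreak n} {H H' : SimpleGraph (Fin n)}
    {join join' : Fin n → Bool} {a : Fin n} (ha : join a = join' a)
    (h : ∀ b, (H.Adj a b ∧ join b = true) ↔ (H'.Adj a b ∧ join' b = true)) :
    partitionLeader pick H join a = partitionLeader pick H' join' a := by
  have hdite : ∀ F F' : Finset (Fin n), F = F' →
      (if h : F.Nonempty then some (pick a F h).1 else none) =
        if h : F'.Nonempty then some (pick a F' h).1 else none := by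
    rintro F _ rfl
    rfl
  unfold partitionLeader
  rw [ha]
  exact congrArg _ (hdite _ _ (by ext b; simpa using h b))

/-- The supergraph at the beginning of level `j`; level `i` uses the coins `c i`. -/
def levelGraph (pick : TieBreak n) (G : SimpleGraph (Fin n)) (c : ℕ → Fin n → Bool) :
    ℕ → SimpleGraph (Fin n)
  | 0 => G
  | j + 1 => contractClusters (levelGraph pick G c j)
      (partitionLeader pick (levelGraph pick G c j) (c j))

/-- The leader of the supernode that `a` joins at level `j`, if any. -/
def levelLeader (pick : TieBreak n) (G : SimpleGraph (Fin n)) (c : ℕ → Fin n → Bool) (j : ℕ) :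
    Fin n → Option (Fin n) :=
  partitionLeader pick (levelGraph pick G c j) (c j)

/-- The effect of level `j` on a cluster: if it is still a supernode of the
supergraph at this level, it joins the cluster given by `leader`, or it is finished. -/
def advance (j : ℕ) (leader : Fin n → Option (Fin n)) (x : Fin n × ℕ) : Fin n × ℕ :=
  if x.2 = j then
    match leader x.1 with
    | none => x
    | some b => (b, j + 1)
  else x

/-- The outcome of the procedure when it is stopped before level `j`: the leader of the cluster of
each vertex, and the index of the set `S_i` that contains this cluster.  The index is `j` for
the clusters that are still supernodes of the supergraph `levelGraph pick G c j`. -/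
def run (pick : TieBreak n) (G : SimpleGraph (Fin n)) (c : ℕ → Fin n → Bool) :
    ℕ → Fin n → Fin n × ℕ
  | 0, v => (v, 0)
  | j + 1, v => advance j (levelLeader pick G c j) (run pick G c j v)

theorem levelGraph_succ_eq (pick : TieBreak n) (G : SimpleGraph (Fin n)) (c : ℕ → Fin n → Bool)
    (j : ℕ) : levelGraph pick G c (j + 1) =
      levelGraph pick (contractClusters G (partitionLeader pick G (c 0)))
        (fun i => c (i + 1)) j := by
  induction j with
  | zero => rfl
  | succ j ih => rw [levelGraph, ih]; rfl

theorem run_succ_eq (pick : TieBreak n) (G : SimpleGraph (Fin n)) (c : ℕ → Fin n → Bool)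
    (j : ℕ) (a : Fin n) : run pick G c (j + 1) a =
      match partitionLeader pick G (c 0) a with
      | none => (a, 0)
      | some b =>
        ((run pick (contractClusters G (partitionLeader pick G (c 0))) (fun i => c (i + 1)) j b).1,
        (run pick (contractClusters G (partitionLeader pick G (c 0))) (fun i => c (i + 1)) j b).2
          + 1) := by
  induction j with
  | zero =>
    simp only [run, advance, levelLeader, levelGraph, if_true, zero_add]
  | succ j ih =>
    rw [run, ih]
    cases h : partitionLeader pick G (c 0) a with
    | none => simp [advance]
    | some b =>
      simp only [run, advance, levelLeader, levelGraph_succ_eq, Nat.add_right_cancel_iff]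
      split_ifs
      · split <;> simp_all
      · rfl

/-- The level at which the procedure stops, counted from a level with bound `s` on the number of
supernodes and with `m` further levels. -/
def stopLevel (q thr : ℝ) : ℕ → ℝ → ℕ
  | 0, _ => 0
  | m + 1, s => if s ≤ thr then 0 else stopLevel q thr m (s / q) + 1

theorem stopLevel_le (q thr : ℝ) (m : ℕ) (s : ℝ) : stopLevel q thr m s ≤ m := by
  induction m generalizing s with
  | zero => exact le_rfl
  | succ m ih =>
    rw [stopLevel]
    split_ifs
    · exact Nat.zero_le _
    · exact Nat.succ_le_succ (ih _)

theorem div_pow_stopLevel_le (q thr : ℝ) (m : ℕ) (s : ℝ) (h : s / q ^ m ≤ thr) :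
    s / q ^ stopLevel q thr m s ≤ thr := by
  induction m generalizing s with
  | zero => simpa [stopLevel] using h
  | succ m ih =>
    rw [stopLevel]
    split_ifs with hs
    · simpa using hs
    · rw [pow_succ', ← div_div] at h ⊢
      exact ih _ h

theorem decomposeLevel_eq_run (pick : TieBreak n) (q thr : ℝ) (m : ℕ)
    (coins : Fin m → Fin n → Bool) (c : ℕ → Fin n → Bool) (hc : ∀ j : Fin m, coins j = c j)
    (i : ℕ) (s : ℝ) (H : SimpleGraph (Fin n)) (a : Fin n) :
    decomposeLevel pick q thr m coins i s H a =
      ((run pick H c (stopLevel q thr m s) a).1, (run pick H c (stopLevel q thr m s) a).2 + i) := by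
  induction m generalizing c i s H a with
  | zero => simp [decomposeLevel, stopLevel, run]
  | succ m ih =>
    rw [decomposeLevel, stopLevel]
    split_ifs with hs
    · simp [run]
    · have h0 : coins 0 = c 0 := hc 0
      rw [run_succ_eq, h0]
      cases h : partitionLeader pick H (c 0) a with
      | none => simp
      | some b =>
        simp only
        rw [ih _ (fun i => c (i + 1)) (fun j => by simpa using hc j.succ)]
        simp only [Prod.mk.injEq, true_and]
        omega

/-- The coins of Procedure Decompose, indexed by level and vertex. -/
def levelCoins {k : ℕ} (ω : Fin n → DecomposeCoin k) (j : ℕ) (v : Fin n) : Bool :=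
  if h : j < k - 1 then ω v ⟨j, h⟩ else false

/-- The number of levels at which Procedure Decompose calls Procedure Partition. -/
def decomposeStop (n : ℕ) (γ : ℝ) (k : ℕ) : ℕ :=
  stopLevel ((n : ℝ) ^ (1 / (k : ℝ))) (2 * γ * (n : ℝ) ^ (1 / (k : ℝ)) * Real.log n) (k - 1) n

theorem decompose_eq_run (γ : ℝ) (k : ℕ) (pick : TieBreak n) (G : SimpleGraph (Fin n))
    (ω : Fin n → DecomposeCoin k) :
    decompose γ k pick G ω = run pick G (levelCoins ω) (decomposeStop n γ k) := by
  funext v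
  rw [decompose, decomposeLevel_eq_run (c := levelCoins ω)]
  · rfl
  · intro j
    funext v
    simp [levelCoins]

variable {pick : TieBreak n} {G : SimpleGraph (Fin n)} {c : ℕ → Fin n → Bool}

theorem advance_of_ne {j : ℕ} {leader : Fin n → Option (Fin n)} {x : Fin n × ℕ} (h : x.2 ≠ j) :
    advance j leader x = x :=
  if_neg h

theorem advance_of_some {j : ℕ} {leader : Fin n → Option (Fin n)} {a b : Fin n}
    (h : leader a = some b) : advance j leader (a, j) = (b, j + 1) := by
  simp [advance, h]

theorem advance_of_none {j : ℕ} {leader : Fin n → Option (Fin n)} {a : Fin n}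
    (h : leader a = none) : advance j leader (a, j) = (a, j) := by
  simp [advance, h]

theorem run_snd_le (j : ℕ) (v : Fin n) : (run pick G c j v).2 ≤ j := by
  induction j with
  | zero => exact le_rfl
  | succ j ih =>
    rw [run, advance]
    split_ifs
    · split
      · omega
      · exact le_rfl
    · omega

/-- Each cluster is finished, or goes on to the next level as a part of the cluster of its
leader. -/
theorem run_succ_cases (j : ℕ) (v : Fin n) :
    (run pick G c (j + 1) v = run pick G c j v) ∨
      ∃ a b, run pick G c j v = (a, j) ∧ levelLeader pick G c j a = some b ∧
        run pick G c (j + 1) v = (b, j + 1) := by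
  by_cases h : (run pick G c j v).2 = j
  · obtain ⟨a, ha⟩ : ∃ a, run pick G c j v = (a, j) := ⟨_, Prod.ext rfl h⟩
    cases hl : levelLeader pick G c j a with
    | none => left; rw [run, ha, advance_of_none hl]
    | some b => exact Or.inr ⟨a, b, ha, hl, by rw [run, ha, advance_of_some hl]⟩
  · left
    rw [run, advance_of_ne h]

theorem run_succ_eq_active {j : ℕ} {v b : Fin n} :
    run pick G c (j + 1) v = (b, j + 1) ↔
      ∃ a, run pick G c j v = (a, j) ∧ levelLeader pick G c j a = some b := by
  constructor
  · intro h
    rcases run_succ_cases (pick := pick) (G := G) (c := c) j v with h' | ⟨a, b', ha, hb, h'⟩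
    · have := run_snd_le (pick := pick) (G := G) (c := c) j v
      rw [← h', h] at this
      simp at this
    · rw [h] at h'
      cases h'
      exact ⟨a, ha, hb⟩
  · rintro ⟨a, ha, hb⟩
    rw [run, ha, advance_of_some hb]

theorem levelGraph_adj {j : ℕ} {a b : Fin n} :
    (levelGraph pick G c j).Adj a b ↔
      a ≠ b ∧ ∃ u w, run pick G c j u = (a, j) ∧ run pick G c j w = (b, j) ∧ G.Adj u w := by
  induction j generalizing a b with
  | zero =>
    simp only [levelGraph, run, Prod.mk.injEq, and_true, exists_and_left, exists_eq_left]
    exact ⟨fun h => ⟨h.ne, h⟩, fun h => h.2⟩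
  | succ j ih =>
    refine and_congr_right fun hab => ?_
    constructor
    · rintro ⟨x, y, hx, hy, hxy⟩
      obtain ⟨-, u, w, hu, hw, huw⟩ := ih.1 hxy
      exact ⟨u, w, run_succ_eq_active.2 ⟨x, hu, hx⟩, run_succ_eq_active.2 ⟨y, hw, hy⟩, huw⟩
    · rintro ⟨u, w, hu, hw, huw⟩
      obtain ⟨x, hux, hx⟩ := run_succ_eq_active.1 hu
      obtain ⟨y, hwy, hy⟩ := run_succ_eq_active.1 hw
      refine ⟨x, y, hx, hy, ih.2 ⟨?_, u, w, hux, hwy, huw⟩⟩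
      rintro rfl
      exact hab (Option.some.inj (hx.symm.trans hy))

/-- A leader belongs to its own cluster. -/
theorem run_leader (j : ℕ) (v : Fin n) :
    run pick G c j (run pick G c j v).1 = run pick G c j v := by
  induction j generalizing v with
  | zero => rfl
  | succ j ih =>
    rcases run_succ_cases (pick := pick) (G := G) (c := c) j v with h | ⟨a, b, ha, hb, h⟩
    · rw [h]
      rw [run, ih v, ← run, h]
    · rw [h]
      refine run_succ_eq_active.2 ⟨b, ?_, ?_⟩
      · rcases (partitionLeader_eq_some hb).2 with rfl | hadj
        · rw [← ha, ← ih v, ha]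
        · obtain ⟨-, u, w, -, hw, -⟩ := levelGraph_adj.1 hadj
          rw [← hw, ← ih w, hw]
      · exact partitionLeader_of_join (partitionLeader_eq_some hb).1

theorem run_eq_of_fst_eq {j : ℕ} {u v : Fin n} (h : (run pick G c j u).1 = (run pick G c j v).1) :
    run pick G c j u = run pick G c j v := by
  rw [← run_leader j u, h, run_leader]

/-- The leader chosen by a supernode is itself a supernode. -/
theorem run_levelLeader {j : ℕ} {v a b : Fin n} (ha : run pick G c j v = (a, j))
    (hb : levelLeader pick G c j a = some b) : run pick G c j b = (b, j) := by
  rcases (partitionLeader_eq_some hb).2 with rfl | hadj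
  · have h := run_leader (pick := pick) (G := G) (c := c) j v
    rwa [ha] at h
  · obtain ⟨-, u, w, -, hw, -⟩ := levelGraph_adj.1 hadj
    have h := run_leader (pick := pick) (G := G) (c := c) j w
    rwa [hw] at h

/-- A supernode has joined the dominating sets of all previous levels. -/
theorem join_of_active {j : ℕ} {v b : Fin n} (h : run pick G c j v = (b, j)) {i : ℕ} (hi : i < j) :
    c i b = true := by
  induction j generalizing v b with
  | zero => omega
  | succ j ih =>
    obtain ⟨a, ha, hb⟩ := run_succ_eq_active.1 h
    rcases Nat.lt_succ_iff_lt_or_eq.1 hi with hi | rfl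
    · exact ih (run_levelLeader ha hb) hi
    · exact (partitionLeader_eq_some hb).1

/-- Any two vertices of a cluster are joined by a walk of length at most `3 ^ j - 1` inside the
cluster: a cluster of the next level is a star of clusters. -/
theorem exists_walk_in_cluster (j : ℕ) (u w : Fin n)
    (h : (run pick G c j u).1 = (run pick G c j w).1) :
    ∃ p : G.Walk u w, p.length + 1 ≤ 3 ^ j ∧
      ∀ x ∈ p.support, run pick G c j x = run pick G c j u := by
  induction j generalizing u w with
  | zero =>
    obtain rfl : u = w := h
    exact ⟨.nil, by simp, by simp⟩
  | succ j ih =>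
    have h' := run_eq_of_fst_eq h
    have hpow : 3 ^ (j + 1) = 3 * 3 ^ j := pow_succ' _ _
    rcases run_succ_cases (pick := pick) (G := G) (c := c) j u with hu | ⟨a, b, hua, hb, hu⟩
    · have hw : run pick G c (j + 1) w = run pick G c j w := by
        rcases run_succ_cases (pick := pick) (G := G) (c := c) j w with hw | ⟨a, b, -, -, hw⟩
        · exact hw
        · have := run_snd_le (pick := pick) (G := G) (c := c) j u
          rw [← hu, h', hw] at this
          simp at this
      obtain ⟨p, hp, hps⟩ := ih u w (by rw [← hu, ← hw, h])
      refine ⟨p, by omega, fun x hx => ?_⟩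
      rw [run, hps x hx, run]
    · -- the way from a member of the cluster of `b` to the center of the star
      have hop : ∀ v, run pick G c (j + 1) v = (b, j + 1) → ∃ v', run pick G c j v' = (b, j) ∧
          ∃ p : G.Walk v v', p.length ≤ 3 ^ j ∧
            ∀ x ∈ p.support, run pick G c (j + 1) x = (b, j + 1) := by
        intro v hv
        obtain ⟨a, hva, hab⟩ := run_succ_eq_active.1 hv
        rcases (partitionLeader_eq_some hab).2 with rfl | hadj
        · exact ⟨v, hva, .nil, by simp, by simpa using hv⟩
        · obtain ⟨-, y, v', hy, hv', hyv⟩ := levelGraph_adj.1 hadj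
          obtain ⟨p, hp, hps⟩ := ih v y (by rw [hva, hy])
          refine ⟨v', hv', p.concat hyv, by rw [SimpleGraph.Walk.length_concat]; omega, ?_⟩
          intro x hx
          rw [SimpleGraph.Walk.support_concat, List.mem_append] at hx
          rcases hx with hx | hx
          · exact run_succ_eq_active.2 ⟨a, (hps x hx).trans hva, hab⟩
          · obtain rfl : x = v' := by simpa using hx
            exact run_succ_eq_active.2
              ⟨b, hv', partitionLeader_of_join (partitionLeader_eq_some hab).1⟩
      obtain ⟨u', hu', p, hp, hps⟩ := hop u hu
      obtain ⟨w', hw', p', hp', hps'⟩ := hop w (h'.symm.trans hu)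
      obtain ⟨m, hm, hms⟩ := ih u' w' (by rw [hu', hw'])
      refine ⟨p.append (m.append p'.reverse), ?_, ?_⟩
      · simp only [SimpleGraph.Walk.length_append, SimpleGraph.Walk.length_reverse]
        omega
      · intro x hx
        rw [hu]
        simp only [SimpleGraph.Walk.mem_support_append_iff, SimpleGraph.Walk.support_reverse,
          List.mem_reverse] at hx
        rcases hx with hx | hx | hx
        · exact hps x hx
        · exact run_succ_eq_active.2 ⟨b, (hms x hx).trans hu',
            partitionLeader_of_join (partitionLeader_eq_some hb).1⟩
        · exact hps' x hx

/-- The leaders of the clusters adjacent to the cluster of `a` that are not in an earlier set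
`S_i`. -/
def laterNbrs (G : SimpleGraph (Fin n)) (out : Fin n → Fin n × ℕ) (a : Fin n) : Set (Fin n) :=
  {b | a ≠ b ∧ ∃ u w, (out u).1 = a ∧ (out w).1 = b ∧ G.Adj u w ∧ (out u).2 ≤ (out w).2}

/-- If supernodes of degree more than `A` are always dominated, then the clusters that are
finished have at most `A` neighbors in their own and the later sets. -/
theorem ncard_laterNbrs_of_finished {A : ℕ} (j : ℕ)
    (hA : ∀ i < j, ∀ a, levelLeader pick G c i a = none →
      {b | (levelGraph pick G c i).Adj a b}.ncard ≤ A)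
    (v : Fin n) (hv : (run pick G c j v).2 < j) :
    (laterNbrs G (run pick G c j) (run pick G c j v).1).ncard ≤ A := by
  induction j generalizing v with
  | zero => omega
  | succ j ih =>
    rcases run_succ_cases (pick := pick) (G := G) (c := c) j v with h | ⟨a, b, -, -, h⟩
    swap
    · rw [h] at hv
      exact absurd hv (lt_irrefl _)
    -- contracting clusters of the supergraph does not increase the number of later neighbors
    have hsub : laterNbrs G (run pick G c (j + 1)) (run pick G c (j + 1) v).1 ⊆
        (fun b => (run pick G c (j + 1) b).1) '' laterNbrs G (run pick G c j)
          (run pick G c j v).1 := by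
      rintro b ⟨hb, u, w, hu, rfl, huw, hl⟩
      have huv := run_eq_of_fst_eq hu
      have hstep : ∀ x, run pick G c (j + 1) (run pick G c j x).1 = run pick G c (j + 1) x :=
        fun x => by rw [run, run_leader, run]
      have huj : run pick G c (j + 1) u = run pick G c j u := by
        rcases run_succ_cases (pick := pick) (G := G) (c := c) j u with h' | ⟨_, _, -, -, h'⟩
        · exact h'
        · rw [← huv, h'] at hv
          exact absurd hv (lt_irrefl _)
      refine ⟨(run pick G c j w).1, ⟨?_, u, w, ?_, rfl, huw, ?_⟩, ?_⟩
      · intro heq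
        apply hb
        rw [← hstep v, heq, hstep]
      · rw [← huj, hu, h]
      · rcases run_succ_cases (pick := pick) (G := G) (c := c) j w with h' | ⟨_, _, h'', -, h'⟩
        · rwa [← huj, ← h']
        · rw [h'']
          exact run_snd_le j u
      · exact congrArg Prod.fst (hstep w)
    refine (Set.ncard_le_ncard hsub (Set.toFinite _)).trans
      ((Set.ncard_image_le (Set.toFinite _)).trans ?_)
    rcases (run_snd_le (pick := pick) (G := G) (c := c) j v).lt_or_eq with hlt | heq
    · exact ih (fun i hi => hA i (by omega)) v hlt
    · obtain ⟨a, ha⟩ : ∃ a, run pick G c j v = (a, j) := ⟨_, Prod.ext rfl heq⟩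
      have hnone : levelLeader pick G c j a = none := by
        cases hl : levelLeader pick G c j a with
        | none => rfl
        | some b =>
          rw [run_succ_eq_active.2 ⟨a, ha, hl⟩] at hv
          exact absurd hv (lt_irrefl _)
      refine le_trans (Set.ncard_le_ncard ?_ (Set.toFinite _)) (hA j (by omega) a hnone)
      rintro b ⟨hb, u, w, hu, hw, huw, hl⟩
      have hu' : run pick G c j u = (a, j) := by rw [run_eq_of_fst_eq hu, ha]
      rw [ha] at hb
      rw [hu'] at hl
      exact levelGraph_adj.2 ⟨hb, u, w, hu',
        Prod.ext hw (le_antisymm (run_snd_le j w) hl), huw⟩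

theorem ncard_laterNbrs_le {A : ℕ} (j : ℕ)
    (hA : ∀ i < j, ∀ a, levelLeader pick G c i a = none →
      {b | (levelGraph pick G c i).Adj a b}.ncard ≤ A)
    (hA' : {b | ∀ i < j, c i b = true}.ncard ≤ A) (a : Fin n) :
    (laterNbrs G (run pick G c j) a).ncard ≤ A := by
  by_cases hv : ∃ v, (run pick G c j v).1 = a
  · obtain ⟨v, rfl⟩ := hv
    rcases (run_snd_le (pick := pick) (G := G) (c := c) j v).lt_or_eq with hlt | heq
    · exact ncard_laterNbrs_of_finished j hA v hlt
    · refine le_trans (Set.ncard_le_ncard ?_ (Set.toFinite _)) hA'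
      rintro b ⟨-, u, w, hu, hw, -, hl⟩ i hi
      rw [run_eq_of_fst_eq hu, heq] at hl
      exact join_of_active (Prod.ext hw (le_antisymm (run_snd_le j w) hl)) hi
  · have : laterNbrs G (run pick G c j) a = ∅ := by
      ext b
      simp only [Set.mem_empty_iff_false, iff_false]
      rintro ⟨-, u, w, hu, -⟩
      exact hv ⟨u, hu⟩
    rw [this, Set.ncard_empty]
    exact Nat.zero_le _

end Run

/-! ### Decompositions, `H`-partitions and labelings in terms of leaders -/

section Good

theorem SimpleGraph.Walk.length_induce_eq {V : Type*} {G : SimpleGraph V} {u v : V} (s : Set V)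
    (p : G.Walk u v) (hp : ∀ x ∈ p.support, x ∈ s) : (p.induce s hp).length = p.length := by
  conv_rhs => rw [← p.map_induce hp]
  exact (SimpleGraph.Walk.length_map _ _).symm

/-- Greedy coloring: the vertices are inserted in the order of descending `lev`. -/
theorem colorable_of_encard_later_le {W : Type*} [Finite W] (H : SimpleGraph W) (lev : W → ℕ)
    (A : ℕ) (h : ∀ C, {C' | H.Adj C C' ∧ lev C ≤ lev C'}.encard ≤ (A : ℕ∞)) :
    H.Colorable (A + 1) := by
  classical
  cases nonempty_fintype W
  suffices hs : ∀ s : Finset W, ∃ φ : W → Fin (A + 1), ∀ x ∈ s, ∀ y ∈ s, H.Adj x y → φ x ≠ φ y by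
    obtain ⟨φ, hφ⟩ := hs Finset.univ
    exact ⟨SimpleGraph.Coloring.mk φ fun {x y} hxy =>
      hφ x (Finset.mem_univ _) y (Finset.mem_univ _) hxy⟩
  intro s
  induction s using Finset.induction_on_min_value lev with
  | empty => exact ⟨fun _ => 0, by simp⟩
  | insert a s ha hmin ih =>
    obtain ⟨φ, hφ⟩ := ih
    obtain ⟨x, hx⟩ : ∃ x, x ∉ φ '' {C' | H.Adj a C' ∧ lev a ≤ lev C'} := by
      by_contra! hall
      have h₁ := (Set.encard_image_le φ _).trans (h a)
      rw [Set.eq_univ_of_forall hall, Set.encard_univ] at h₁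
      simp only [ENat.card_eq_coe_fintype_card, Fintype.card_fin] at h₁
      exact absurd (by exact_mod_cast h₁ : A + 1 ≤ A) (by omega)
    have hx' : ∀ y ∈ s, H.Adj a y → x ≠ φ y := fun y hy hay heq =>
      hx ⟨y, ⟨hay, hmin y hy⟩, heq.symm⟩
    have hne : ∀ y ∈ s, y ≠ a := fun y hy => ne_of_mem_of_not_mem hy ha
    refine ⟨Function.update φ a x, ?_⟩
    intro y hy z hz hyz
    rcases Finset.mem_insert.1 hy with rfl | hy' <;>
      rcases Finset.mem_insert.1 hz with rfl | hz'
    · exact absurd hyz H.irrefl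
    · rw [Function.update_self, Function.update_of_ne (hne z hz')]
      exact hx' z hz' hyz
    · rw [Function.update_self, Function.update_of_ne (hne y hy')]
      exact (hx' y hy' hyz.symm).symm
    · rw [Function.update_of_ne (hne y hy'), Function.update_of_ne (hne z hz')]
      exact hφ y hy' z hz' hyz

variable {n : ℕ}

/-- The leader of a cluster. -/
def clusterLeader (out : Fin n → Fin n × ℕ) : Quotient (clusters out) → Fin n :=
  Quotient.lift (fun v => (out v).1) fun _ _ h => h

theorem clusterLeader_injective (out : Fin n → Fin n × ℕ) :
    Function.Injective (clusterLeader out) := by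
  intro C C'
  refine Quotient.inductionOn₂ C C' fun u w h => ?_
  exact Quotient.sound h

variable {G : SimpleGraph (Fin n)} {out : Fin n → Fin n × ℕ}

theorem clusterLeader_mem_laterNbrs (hout : ∀ v, out (out v).1 = out v)
    {C C' : Quotient (clusters out)} (h : (supergraph G (clusters out)).Adj C C')
    (hl : (out (clusterLeader out C)).2 ≤ (out (clusterLeader out C')).2) :
    clusterLeader out C' ∈ laterNbrs G out (clusterLeader out C) := by
  obtain ⟨hne, u, w, rfl, rfl, huw⟩ := h
  refine ⟨fun heq => hne (clusterLeader_injective out heq), u, w, rfl, rfl, huw, ?_⟩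
  have h₁ : (out (out u).1).2 ≤ (out (out w).1).2 := hl
  rwa [hout, hout] at h₁

theorem encard_later_le (hout : ∀ v, out (out v).1 = out v) {A : ℕ}
    (hA : ∀ a, (laterNbrs G out a).ncard ≤ A) (C : Quotient (clusters out)) :
    {C' | (supergraph G (clusters out)).Adj C C' ∧
      (out (clusterLeader out C)).2 ≤ (out (clusterLeader out C')).2}.encard ≤ (A : ℕ∞) := by
  rw [← (clusterLeader_injective out).encard_image]
  refine (Set.encard_le_encard ?_).trans
    (b := (laterNbrs G out (clusterLeader out C)).encard) ?_
  · rintro _ ⟨C', ⟨hadj, hl⟩, rfl⟩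
    exact clusterLeader_mem_laterNbrs hout hadj hl
  · rw [← (Set.toFinite (laterNbrs G out (clusterLeader out C))).cast_ncard_eq]
    exact_mod_cast hA _

theorem isHPartition_of_ncard_laterNbrs_le (hout : ∀ v, out (out v).1 = out v) {A k : ℕ}
    (hk : ∀ v, (out v).2 < k) (hA : ∀ a, (laterNbrs G out a).ncard ≤ A) :
    IsHPartition (supergraph G (clusters out)) (clusterSets k out) A := by
  have hmem : ∀ (i : Fin k) (C : Quotient (clusters out)), C ∈ clusterSets k out i ↔
      (out (clusterLeader out C)).2 = i := by
    intro i C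
    refine Quotient.inductionOn C fun v => ?_
    constructor
    · rintro ⟨w, hw, hi⟩
      rw [← hw, ← hi]
      exact congrArg Prod.snd (hout w)
    · intro hi
      exact ⟨v, rfl, by rw [← hi]; exact (congrArg Prod.snd (hout v)).symm⟩
  refine ⟨fun i j hij => ?_, ?_, fun i C hC => ?_⟩
  · rw [Set.disjoint_left]
    intro C hi hj
    rw [hmem] at hi hj
    exact hij (Fin.ext (hi.symm.trans hj))
  · ext C
    simp only [Set.mem_iUnion, Set.mem_univ, iff_true]
    exact ⟨⟨_, hk (clusterLeader out C)⟩, (hmem _ C).2 rfl⟩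
  · refine (Set.encard_le_encard ?_).trans (encard_later_le hout hA C)
    rintro C' ⟨hadj, j, hij, hC'⟩
    refine ⟨hadj, ?_⟩
    rw [(hmem i C).1 hC, (hmem j C').1 hC']
    exact hij

theorem isLabeling_of_color {p : ℕ} (col : Fin n → ℕ) (hp : ∀ v, col (out v).1 < p)
    (hcol : ∀ u w, G.Adj u w → (out u).1 ≠ (out w).1 → col (out u).1 ≠ col (out w).1) :
    IsLabeling G (clusters out) p fun v => col (out v).1 := by
  have hlt : ∀ C : Quotient (clusters out), col (clusterLeader out C) < p :=
    fun C => Quotient.inductionOn C hp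
  refine ⟨SimpleGraph.Coloring.mk (fun C => ⟨col (clusterLeader out C), hlt C⟩) ?_, fun v => rfl⟩
  rintro C C' ⟨hne, u, w, rfl, rfl, huw⟩ heq
  exact hcol u w huw (fun h => hne (clusterLeader_injective out h)) (congrArg Fin.val heq)

theorem isGoodDecomposition_run {pick : TieBreak n} {c : ℕ → Fin n → Bool} {C : ℝ} {k j A : ℕ}
    (hk : 1 ≤ k) (hj : j ≤ k - 1) (hA : ∀ a, (laterNbrs G (run pick G c j) a).ncard ≤ A)
    (hAC : A + 1 ≤ ⌊C * (n : ℝ) ^ (1 / (k : ℝ)) * Real.log n⌋₊) :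
    IsGoodDecomposition C k G (run pick G c j) := by
  have hout := run_leader (pick := pick) (G := G) (c := c) j
  refine ⟨⟨fun C => ?_, ?_⟩, ?_⟩
  · obtain ⟨v, rfl⟩ := Quotient.exists_rep C
    refine SimpleGraph.ediam_le_iff.2 ?_
    rintro ⟨u, hu⟩ ⟨w, hw⟩
    have hu' : (run pick G c j u).1 = (run pick G c j v).1 := Quotient.exact hu
    have hw' : (run pick G c j w).1 = (run pick G c j v).1 := Quotient.exact hw
    obtain ⟨p, hp, hps⟩ := exists_walk_in_cluster j u w (hu'.trans hw'.symm)
    have hpow : 3 ^ j ≤ 3 ^ (k - 1) := Nat.pow_le_pow_right (by norm_num) hj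
    have hmem : ∀ x ∈ p.support, x ∈ {x | (⟦x⟧ : Quotient (clusters (run pick G c j))) = ⟦v⟧} :=
      fun x hx => Quotient.sound (s := clusters (run pick G c j))
        ((congrArg Prod.fst (hps x hx)).trans hu')
    refine (SimpleGraph.edist_le (p.induce _ hmem)).trans ?_
    rw [SimpleGraph.Walk.length_induce_eq]
    exact_mod_cast (by omega : p.length ≤ 3 ^ (k - 1) - 1)
  · exact (colorable_of_encard_later_le _ _ A (encard_later_le hout hA)).mono hAC
  · refine isHPartition_of_ncard_laterNbrs_le hout (fun v => ?_) fun a => (hA a).trans (by omega)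
    have := run_snd_le (pick := pick) (G := G) (c := c) j v
    omega

end Good

/-! ### Locality of Procedure Decompose -/

section RunLocal

variable {n : ℕ}

theorem IsLocal.prodMk {Coin X Y : Type*} {r : ℕ}
    {F : SimpleGraph (Fin n) → (Fin n → Coin) → Fin n → X}
    {F' : SimpleGraph (Fin n) → (Fin n → Coin) → Fin n → Y} (hF : IsLocal r F)
    (hF' : IsLocal r F') : IsLocal r fun G ω v => (F G ω v, F' G ω v) :=
  fun _ _ _ _ v ha => Prod.ext (hF _ _ _ _ v ha) (hF' _ _ _ _ v ha)

theorem IsLocal.comp {Coin X Y : Type*} {r : ℕ}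
    {F : SimpleGraph (Fin n) → (Fin n → Coin) → Fin n → X} (hF : IsLocal r F) (g : X → Y) :
    IsLocal r fun G ω v => g (F G ω v) :=
  fun _ _ _ _ v ha => congrArg g (hF _ _ _ _ v ha)

theorem isLocal_coin {Coin X : Type*} (r : ℕ) (g : Coin → X) :
    IsLocal r fun (_ : SimpleGraph (Fin n)) (ω : Fin n → Coin) v => g (ω v) :=
  fun _ _ _ _ _ ha => congrArg g ha.coin_eq

theorem exists_walk_leader {G : SimpleGraph (Fin n)} (pick : TieBreak n) (c : ℕ → Fin n → Bool)
    (j : ℕ) (v : Fin n) : ∃ p : G.Walk v (run pick G c j v).1, p.length ≤ 3 ^ j - 1 := by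
  obtain ⟨p, hp, -⟩ := exists_walk_in_cluster (pick := pick) (c := c) j v (run pick G c j v).1
    (by rw [run_leader])
  exact ⟨p, by omega⟩

/-- The radius of a cluster triples at each level, and so does the distance up to which a vertex
has to look in order to find its cluster. -/
theorem isLocal_run (pick : TieBreak n) (k j : ℕ) :
    IsLocal (2 * 3 ^ j) fun G (ω : Fin n → DecomposeCoin k) v =>
      run pick G (levelCoins ω) j v := by
  induction j with
  | zero => exact fun _ _ _ _ _ _ => rfl
  | succ j ih =>
    have hpos : 1 ≤ 3 ^ j := Nat.one_le_pow _ _ (by norm_num)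
    have hpow : 3 ^ (j + 1) = 3 * 3 ^ j := pow_succ' _ _
    have hℓ := ih.comp Prod.fst
    have hd : ∀ (G : SimpleGraph (Fin n)) (ω : Fin n → DecomposeCoin k) v,
        ∃ p : G.Walk v (run pick G (levelCoins ω) j v).1, p.length ≤ 3 ^ j - 1 :=
      fun G ω v => exists_walk_leader pick _ j v
    have hcoin : IsLocal 0 fun (_ : SimpleGraph (Fin n)) (ω : Fin n → DecomposeCoin k) v =>
        levelCoins ω j v :=
      isLocal_coin 0 fun x : DecomposeCoin k => if h : j < k - 1 then x ⟨j, h⟩ else false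
    have hE := IsLocal.boundary (t := 3 * 3 ^ j) hℓ
      (ih.prodMk (hℓ.eval hcoin hd le_rfl (by omega))) hd (by omega)
    have hmem : ∀ (G : SimpleGraph (Fin n)) (ω : Fin n → DecomposeCoin k) a b,
        ((levelGraph pick G (levelCoins ω) j).Adj a b ∧ levelCoins ω j b = true) ↔
        (a ≠ b ∧ ∃ y ∈ {y : ((Fin n × ℕ) × Bool) × ((Fin n × ℕ) × Bool) | ∃ u w,
          (run pick G (levelCoins ω) j u).1 = a ∧ G.Adj u w ∧
          y = ((run pick G (levelCoins ω) j u, levelCoins ω j (run pick G (levelCoins ω) j u).1),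
            (run pick G (levelCoins ω) j w, levelCoins ω j (run pick G (levelCoins ω) j w).1))},
          y.1.1.2 = j ∧ y.2.1 = (b, j) ∧ y.2.2 = true) := by
      intro G ω a b
      rw [levelGraph_adj]
      constructor
      · rintro ⟨⟨hab, u, w, hu, hw, huw⟩, hb⟩
        exact ⟨hab, _, ⟨u, w, by rw [hu], huw, rfl⟩, by rw [hu], hw, by rw [hw]; exact hb⟩
      · rintro ⟨hab, _, ⟨u, w, hu, huw, rfl⟩, hu', hw, hb⟩
        simp only at hu' hw hb
        rw [hw] at hb
        exact ⟨⟨hab, u, w, Prod.ext hu hu', hw, huw⟩, hb⟩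
    have hleader : IsLocal (3 * 3 ^ j) fun G (ω : Fin n → DecomposeCoin k) a =>
        levelLeader pick G (levelCoins ω) j a := by
      intro G G' ω ω' a ha
      refine partitionLeader_congr (hcoin _ _ _ _ a (ha.mono (Nat.zero_le _))) fun b => ?_
      have := hE G G' ω ω' a ha
      simp only at this
      rw [hmem, hmem, this]
    have hstep := (ih.mono (s := 2 * 3 ^ (j + 1)) (by omega)).prodMk
      (hℓ.eval (t := 2 * 3 ^ (j + 1)) hleader hd (by omega) (by omega))
    intro G G' ω ω' v ha
    obtain ⟨h₁, h₂⟩ := Prod.ext_iff.1 (hstep G G' ω ω' v ha)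
    simp only at h₁ h₂
    simp only [run, advance, h₂]
    simp only [h₁]

end RunLocal

/-! ### Tools for independent coins -/

section Coins

/-- If for all values of the other coordinates the event has probability at most `ε` over
the choice of one coordinate, then it has probability at most `ε`. -/
theorem measure_pi_le_of_update {ι : Type*} [Fintype ι] [DecidableEq ι] {X : ι → Type*}
    [∀ i, MeasurableSpace (X i)] (μ : ∀ i, Measure (X i)) [∀ i, IsProbabilityMeasure (μ i)]
    {E : Set (∀ i, X i)} (hE : MeasurableSet E) (i : ι) (ε : ℝ≥0∞)
    (h : ∀ x, μ i {z | Function.update x i z ∈ E} ≤ ε) : Measure.pi μ E ≤ ε := by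
  obtain ⟨x₀⟩ := (Measure.pi μ).nonempty_of_neZero
  rw [← lintegral_indicator_one hE, lintegral_eq_lmarginal_univ x₀,
    lmarginal_erase' _ (measurable_one.indicator hE) (Finset.mem_univ i)]
  calc (∫⋯∫⁻_Finset.univ.erase i,
        (fun x => ∫⁻ z, E.indicator 1 (Function.update x i z) ∂μ i) ∂μ) x₀
      ≤ (∫⋯∫⁻_Finset.univ.erase i, (fun _ => ε) ∂μ) x₀ := by
        refine lmarginal_mono (fun x => ?_) x₀
        refine le_trans (le_of_eq ?_) (h x)
        have hm : MeasurableSet {z | Function.update x i z ∈ E} :=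
          measurable_update x hE
        rw [← lintegral_indicator_one hm]
        rfl
    _ = ε := by simp [lmarginal]

theorem measure_pi_forall_mem {ι X : Type*} [Fintype ι] [MeasurableSpace X] (μ : Measure X)
    [IsProbabilityMeasure μ] (S : Finset ι) (T : Set X) :
    (Measure.pi fun _ : ι => μ) {x | ∀ i ∈ S, x i ∈ T} = μ T ^ S.card := by
  classical
  have h : {x : ι → X | ∀ i ∈ S, x i ∈ T} =
      Set.univ.pi fun i => if i ∈ S then T else Set.univ := by
    ext x
    simp only [Set.mem_ofPred_eq, Set.mem_pi, Set.mem_univ, true_imp_iff]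
    refine forall_congr' fun i => ?_
    by_cases hi : i ∈ S <;> simp [hi]
  rw [h, Measure.pi_pi, ← Finset.prod_const, ← Finset.prod_filter_mul_prod_filter_not
    Finset.univ (· ∈ S)]
  rw [Finset.prod_congr rfl (g := fun _ => μ T) (by simp +contextual),
    Finset.prod_congr rfl (g := fun _ => (1 : ℝ≥0∞)) (s₁ := Finset.univ.filter (· ∉ S))
      (by simp +contextual)]
  simp

/-- Exchanging the two indices of a finite family of independent coins. -/
theorem measurePreserving_flip {ι κ X : Type*} [Fintype ι] [Fintype κ] [Finite X]
    [MeasurableSpace X] [MeasurableSingletonClass X] (μ : Measure X) [IsProbabilityMeasure μ] :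
    MeasurePreserving (fun (x : ι → κ → X) j i => x i j)
      (Measure.pi fun _ : ι => Measure.pi fun _ : κ => μ)
      (Measure.pi fun _ : κ => Measure.pi fun _ : ι => μ) := by
  have hm : Measurable (fun (x : ι → κ → X) j i => x i j) := by fun_prop
  refine ⟨hm, Measure.ext_of_singleton fun y => ?_⟩
  rw [Measure.map_apply hm (measurableSet_singleton _)]
  have : (fun (x : ι → κ → X) j i => x i j) ⁻¹' {y} = {fun i j => y j i} := by
    ext x
    simp only [Set.mem_preimage, Set.mem_singleton_iff]
    exact ⟨fun h => by rw [← h], fun h => by rw [h]⟩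
  rw [this]
  simp only [Measure.pi_singleton]
  exact Finset.prod_comm

/-- If the set `F τ x` of forbidden values at position `τ` depends only on the values of `x` at the
earlier positions, and has at most `B τ` members, then at most `∏ B τ` sequences have a forbidden
value at each position. -/
theorem ncard_forall_mem_le {α : Type*} [Finite α] {M : ℕ} (F : Fin M → (Fin M → α) → Finset α)
    (B : Fin M → ℕ) (hF : ∀ τ x y, (∀ i < τ, x i = y i) → F τ x = F τ y)
    (hB : ∀ τ x, (F τ x).card ≤ B τ) :
    {x : Fin M → α | ∀ τ, x τ ∈ F τ x}.ncard ≤ ∏ τ, B τ := by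
  let f : {x : Fin M → α | ∀ τ, x τ ∈ F τ x} → ∀ τ, Fin (B τ) :=
    fun x τ => Fin.castLE (hB τ x) ((F τ x).equivFin ⟨x.1 τ, x.2 τ⟩)
  have hinj : Function.Injective f := by
    rintro ⟨x, hx⟩ ⟨y, hy⟩ hxy
    refine Subtype.ext (funext fun τ => ?_)
    change x τ = y τ
    induction τ using WellFoundedLT.induction with
    | ind τ ih =>
      have hS := hF τ x y ih
      have hval : ∀ (S S' : Finset α) (a b : α) (ha : a ∈ S) (hb : b ∈ S'), S = S' →
          (S.equivFin ⟨a, ha⟩ : ℕ) = S'.equivFin ⟨b, hb⟩ → a = b := by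
        rintro S _ a b ha hb rfl heq
        exact congrArg Subtype.val (S.equivFin.injective (Fin.ext heq))
      exact hval _ _ _ _ (hx τ) (hy τ) hS (congrArg Fin.val (congrFun hxy τ))
  have := Nat.card_le_card_of_injective f hinj
  rwa [Nat.card_coe_set_eq, Nat.card_pi, Finset.prod_congr rfl fun τ _ => Nat.card_fin (B τ)]
    at this

theorem uniformOn_univ_le {Ω : Type*} [Fintype Ω] [MeasurableSpace Ω] [MeasurableSingletonClass Ω]
    {E : Set Ω} {a : ℕ} (h : E.ncard ≤ a) :
    ProbabilityTheory.uniformOn Set.univ E ≤ (a : ℝ≥0∞) / Fintype.card Ω := by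
  rw [ProbabilityTheory.uniformOn_univ, Measure.count_apply (Set.toFinite E).measurableSet,
    ← (Set.toFinite E).cast_ncard_eq]
  gcongr
  exact_mod_cast h

end Coins

/-! ### The probability of a bad decomposition -/

section Probability

variable {n : ℕ}

theorem levelGraph_congr {pick : TieBreak n} {G : SimpleGraph (Fin n)} {c c' : ℕ → Fin n → Bool}
    {j : ℕ} (h : ∀ i < j, c i = c' i) : levelGraph pick G c j = levelGraph pick G c' j := by
  induction j with
  | zero => rfl
  | succ j ih => rw [levelGraph, levelGraph, ih fun i hi => h i (by omega), h j (by omega)]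

theorem decomposeLaw_eq (n k : ℕ) : decomposeLaw n k =
    Measure.pi fun _ => ProbabilityTheory.bernoulliMeasure true false
      ⟨((n : ℝ) ^ (1 / (k : ℝ)))⁻¹, inv_rpow_mem_unitInterval n k⟩ := rfl

instance (n k : ℕ) : IsProbabilityMeasure (decomposeLaw n k) := by
  rw [decomposeLaw_eq]
  infer_instance

theorem bernoulliMeasure_true (p : unitInterval) :
    ProbabilityTheory.bernoulliMeasure true false p {true} = ENNReal.ofReal p := by
  classical
  rw [ProbabilityTheory.bernoulliMeasure_apply _ (measurableSet_singleton _)]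
  simp [ENNReal.ofReal, unitInterval.toNNReal, Real.toNNReal_of_nonneg p.2.1]
  rfl

theorem bernoulliMeasure_false (p : unitInterval) :
    ProbabilityTheory.bernoulliMeasure true false p {false} = ENNReal.ofReal (1 - p) := by
  classical
  rw [ProbabilityTheory.bernoulliMeasure_apply _ (measurableSet_singleton _)]
  have h : (0 : ℝ) ≤ 1 - p := sub_nonneg.2 p.2.2
  simp [ENNReal.ofReal, unitInterval.toNNReal, Real.toNNReal_of_nonneg h]
  rfl

/-- It is unlikely that a supernode of large degree is not dominated: neither the supernode nor any
of its at least `A + 1` neighbors has joined the dominating set. -/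
theorem measure_undominated_le (pick : TieBreak n) (G : SimpleGraph (Fin n)) (k A j : ℕ)
    (hj : j < k - 1) (a : Fin n) :
    (Measure.pi fun _ : Fin n => decomposeLaw n k)
      {ω | levelLeader pick G (levelCoins ω) j a = none ∧
        A < {b | (levelGraph pick G (levelCoins ω) j).Adj a b}.ncard} ≤
      ENNReal.ofReal ((1 - ((n : ℝ) ^ (1 / (k : ℝ)))⁻¹) ^ (A + 2)) := by
  classical
  set p : unitInterval := ⟨((n : ℝ) ^ (1 / (k : ℝ)))⁻¹, inv_rpow_mem_unitInterval n k⟩ with hp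
  have hp1 : (0 : ℝ) ≤ 1 - p := sub_nonneg.2 p.2.2
  let ext : (Fin (k - 1) → Fin n → Bool) → ℕ → Fin n → Bool :=
    fun y i v => if h : i < k - 1 then y ⟨i, h⟩ v else false
  let E : Set (Fin (k - 1) → Fin n → Bool) := {y | levelLeader pick G (ext y) j a = none ∧
    A < {b | (levelGraph pick G (ext y) j).Adj a b}.ncard}
  have hflip := measurePreserving_flip (ι := Fin n) (κ := Fin (k - 1))
    (ProbabilityTheory.bernoulliMeasure true false p)
  have hpre := hflip.measure_preimage (s := E) (MeasurableSet.of_discrete).nullMeasurableSet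
  rw [show (Measure.pi fun _ : Fin n => decomposeLaw n k)
      {ω | levelLeader pick G (levelCoins ω) j a = none ∧
        A < {b | (levelGraph pick G (levelCoins ω) j).Adj a b}.ncard} = _ from hpre]
  refine measure_pi_le_of_update _ MeasurableSet.of_discrete ⟨j, hj⟩ _ fun y => ?_
  -- the supergraph does not depend on the coins of its own level
  have hgraph : ∀ z, levelGraph pick G (ext (Function.update y ⟨j, hj⟩ z)) j =
      levelGraph pick G (ext y) j := by
    intro z
    refine levelGraph_congr fun i hi => funext fun v => ?_
    have hne : ∀ h : i < k - 1, (⟨i, h⟩ : Fin (k - 1)) ≠ ⟨j, hj⟩ := fun _ h =>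
      absurd (congrArg Fin.val h) hi.ne
    simp only [ext]
    split_ifs with h
    · rw [Function.update_of_ne (hne h)]
    · rfl
  set N : Finset (Fin n) := Finset.univ.filter fun b => (levelGraph pick G (ext y) j).Adj a b
    with hN
  have hNc : {b | (levelGraph pick G (ext y) j).Adj a b}.ncard = N.card := by
    rw [← Set.ncard_coe_finset]
    congr 1
    ext b
    simp [hN]
  have haN : a ∉ N := by simp [hN]
  by_cases hA : A < N.card
  · calc (Measure.pi fun _ : Fin n => ProbabilityTheory.bernoulliMeasure true false p)
          {z | Function.update y ⟨j, hj⟩ z ∈ E}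
        ≤ (Measure.pi fun _ : Fin n => ProbabilityTheory.bernoulliMeasure true false p)
          {z | ∀ b ∈ insert a N, z b ∈ ({false} : Set Bool)} := by
          refine measure_mono ?_
          rintro z ⟨hz, -⟩
          have hz' := partitionLeader_eq_none hz
          rw [hgraph] at hz'
          have hext : ∀ b, ext (Function.update y ⟨j, hj⟩ z) j b = z b := fun b => by
            simp [ext, hj]
          simp only [hext] at hz'
          intro b hb
          rcases Finset.mem_insert.1 hb with rfl | hb
          · exact hz'.1
          · exact hz'.2 b (by simpa [hN] using hb)
      _ = ENNReal.ofReal ((1 - p) ^ (N.card + 1)) := by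
          rw [measure_pi_forall_mem, Finset.card_insert_of_notMem haN, bernoulliMeasure_false,
            ENNReal.ofReal_pow hp1]
      _ ≤ _ := by
          refine ENNReal.ofReal_le_ofReal (pow_le_pow_of_le_one hp1 ?_ (by omega))
          linarith [p.2.1]
  · have hempty : {z | Function.update y ⟨j, hj⟩ z ∈ E} = ∅ := by
      refine Set.eq_empty_iff_forall_notMem.2 ?_
      rintro z ⟨-, hz⟩
      rw [hgraph, hNc] at hz
      exact hA hz
    rw [hempty, measure_empty]
    exact zero_le

/-- The number of members of `n` independent events of probability at most `P` that occur: its tail,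
by the union bound over the sets of events that may occur. -/
theorem measure_card_ge_le {X : Type*} [MeasurableSpace X] (μ : Measure X)
    [IsProbabilityMeasure μ] (T : Set X) {P : ℝ} (hP : 0 ≤ P) (hT : μ T ≤ ENNReal.ofReal P)
    (R : ℕ) :
    (Measure.pi fun _ : Fin n => μ) {x | R ≤ {v | x v ∈ T}.ncard} ≤
      ENNReal.ofReal (Real.exp (Real.exp 1 * (n * P) - R)) := by
  classical
  have hsub : {x : Fin n → X | R ≤ {v | x v ∈ T}.ncard} ⊆
      ⋃ S ∈ Finset.powersetCard R (Finset.univ : Finset (Fin n)), {x | ∀ v ∈ S, x v ∈ T} := by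
    intro x hx
    have hx' : R ≤ (Finset.univ.filter fun v => x v ∈ T).card := by
      rw [← Set.ncard_coe_finset]
      simpa using hx
    obtain ⟨S, hS, hc⟩ := Finset.exists_subset_card_eq hx'
    refine Set.mem_biUnion (x := S)
      (Finset.mem_coe.2 (Finset.mem_powersetCard.2 ⟨Finset.subset_univ _, hc⟩)) fun v hv => ?_
    exact (Finset.mem_filter.1 (hS hv)).2
  refine (measure_mono hsub).trans ((measure_biUnion_finset_le _ _).trans ?_)
  calc ∑ S ∈ Finset.powersetCard R (Finset.univ : Finset (Fin n)),
        (Measure.pi fun _ : Fin n => μ) {x | ∀ v ∈ S, x v ∈ T}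
      ≤ ∑ S ∈ Finset.powersetCard R (Finset.univ : Finset (Fin n)), ENNReal.ofReal (P ^ R) := by
        refine Finset.sum_le_sum fun S hS => ?_
        rw [measure_pi_forall_mem, (Finset.mem_powersetCard.1 hS).2, ENNReal.ofReal_pow hP]
        gcongr
    _ = ENNReal.ofReal (n.choose R * P ^ R) := by
        rw [Finset.sum_const, Finset.card_powersetCard, Finset.card_univ, Fintype.card_fin,
          nsmul_eq_mul, ENNReal.ofReal_mul (by positivity), ENNReal.ofReal_natCast]
    _ ≤ _ := by
        refine ENNReal.ofReal_le_ofReal ?_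
        calc (n.choose R : ℝ) * P ^ R ≤ (n : ℝ) ^ R / R.factorial * P ^ R := by
              gcongr
              exact Nat.choose_le_pow_div R n
          _ = (Real.exp 1 * (n * P)) ^ R / R.factorial * Real.exp (-R) := by
              rw [mul_pow, mul_pow, ← Real.exp_nat_mul, mul_one, Real.exp_neg]
              field_simp
          _ ≤ Real.exp (Real.exp 1 * (n * P)) * Real.exp (-R) := by
              gcongr
              exact Real.pow_div_factorial_le_exp _ (by positivity) R
          _ = _ := by rw [← Real.exp_add, sub_eq_add_neg]

/-- The number of supernodes that are left after `J` levels is unlikely to be much larger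
than its expectation. -/
theorem measure_survivors_le (k J R : ℕ) (hJ : J ≤ k - 1) :
    (Measure.pi fun _ : Fin n => decomposeLaw n k)
      {ω | R ≤ {b | ∀ i < J, levelCoins ω i b = true}.ncard} ≤
      ENNReal.ofReal (Real.exp
        (Real.exp 1 * (n * (((n : ℝ) ^ (1 / (k : ℝ)))⁻¹) ^ J) - R)) := by
  set p : unitInterval := ⟨((n : ℝ) ^ (1 / (k : ℝ)))⁻¹, inv_rpow_mem_unitInterval n k⟩ with hp
  let S : Finset (Fin (k - 1)) := Finset.univ.filter fun i => (i : ℕ) < J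
  have hS : S.card = J := by
    have : S = Finset.univ.map (Fin.castLEEmb hJ) := by
      ext i
      simp only [S, Finset.mem_filter, Finset.mem_univ, true_and, Finset.mem_map]
      exact ⟨fun h => ⟨⟨i, h⟩, rfl⟩, by rintro ⟨x, rfl⟩; exact x.2⟩
    rw [this, Finset.card_map, Finset.card_univ, Fintype.card_fin]
  have hT : decomposeLaw n k {x | ∀ i ∈ S, x i ∈ ({true} : Set Bool)} ≤
      ENNReal.ofReal ((p : ℝ) ^ J) := by
    rw [decomposeLaw_eq, measure_pi_forall_mem, bernoulliMeasure_true, hS,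
      ENNReal.ofReal_pow p.2.1]
  refine le_trans (le_of_eq ?_) (measure_card_ge_le (n := n) (decomposeLaw n k)
    {x | ∀ i ∈ S, x i ∈ ({true} : Set Bool)} (pow_nonneg p.2.1 J) hT R)
  congr 1
  ext ω
  simp only [Set.mem_ofPred_eq]
  have : {b | ∀ i < J, levelCoins ω i b = true} =
      {v | ∀ i ∈ S, ω v i ∈ ({true} : Set Bool)} := by
    ext v
    simp only [Set.mem_ofPred_eq, S, Finset.mem_filter, Finset.mem_univ, true_and,
      Set.mem_singleton_iff]
    constructor
    · intro h i hi
      simpa [levelCoins] using h i hi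
    · intro h i hi
      have hi' : i < k - 1 := by omega
      simpa [levelCoins, hi'] using h ⟨i, hi'⟩ hi
  rw [this]

end Probability

section Bound

variable {n : ℕ}

/-- The bound on the number of later neighbors of a cluster that holds with high probability.  With
`q = n^(1/k)`, a supernode of larger degree is undominated with probability at most
`exp (-(c + 4) log n)`, and `6 γ q log n` exceeds `e` times the termination threshold
`2 γ q log n`, which leaves `(c + 4) q log n` for the tail of the number of remaining supernodes. -/
def degreeBound (c γ : ℝ) (n k : ℕ) : ℕ :=
  ⌊(6 * γ + c + 4) * (n : ℝ) ^ (1 / (k : ℝ)) * Real.log n⌋₊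

theorem half_lt_log {n : ℕ} (hn : 2 ≤ n) : 1 / 2 < Real.log n := by
  have h : Real.log 2 ≤ Real.log n := Real.log_le_log (by norm_num) (by exact_mod_cast hn)
  linarith [Real.log_two_gt_d9]

theorem one_le_root {n : ℕ} (hn : 2 ≤ n) (k : ℕ) : 1 ≤ (n : ℝ) ^ (1 / (k : ℝ)) :=
  Real.one_le_rpow (by exact_mod_cast (by omega : 1 ≤ n)) (by positivity)

theorem root_pow {n k : ℕ} (hk : 1 ≤ k) : ((n : ℝ) ^ (1 / (k : ℝ))) ^ k = n := by
  rw [one_div]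
  exact Real.rpow_inv_natCast_pow (Nat.cast_nonneg n) (by omega)

/-- The expected number of supernodes at the last level is at most the termination threshold. -/
theorem mul_inv_pow_decomposeStop_le {γ : ℝ} (hγ : 1 ≤ γ) {k : ℕ} (hn : 2 ≤ n) (hk : 1 ≤ k) :
    (n : ℝ) * (((n : ℝ) ^ (1 / (k : ℝ)))⁻¹) ^ decomposeStop n γ k ≤
      2 * γ * (n : ℝ) ^ (1 / (k : ℝ)) * Real.log n := by
  have hq := one_le_root hn k
  rw [inv_pow, ← div_eq_mul_inv]
  refine div_pow_stopLevel_le _ _ _ _ ?_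
  have hpow : (n : ℝ) = (n : ℝ) ^ (1 / (k : ℝ)) * ((n : ℝ) ^ (1 / (k : ℝ))) ^ (k - 1) := by
    rw [← pow_succ', Nat.sub_add_cancel hk, root_pow hk]
  have hlast : (n : ℝ) / ((n : ℝ) ^ (1 / (k : ℝ))) ^ (k - 1) = (n : ℝ) ^ (1 / (k : ℝ)) := by
    rw [div_eq_iff (by positivity)]
    exact hpow
  rw [hlast]
  have h : 1 ≤ 2 * γ * Real.log n := by nlinarith [half_lt_log hn]
  nlinarith

theorem le_degreeBound_add_one (c γ : ℝ) (n k : ℕ) :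
    (6 * γ + c + 4) * (n : ℝ) ^ (1 / (k : ℝ)) * Real.log n ≤ (degreeBound c γ n k : ℝ) + 1 :=
  (Nat.lt_floor_add_one _).le

/-- The union bound over all levels and vertices.  One factor `1 - 1 / n^(1/k)`, which is at most
`log n / k`, compensates for the number of levels. -/
theorem sum_undominated_le {c γ : ℝ} (hc : 0 < c) (hγ : 1 ≤ γ) {k : ℕ} (hn : 2 ≤ n) (hk : 1 ≤ k)
    {J : ℕ} (hJ : J ≤ k - 1) :
    (J : ℝ) * (n * (1 - ((n : ℝ) ^ (1 / (k : ℝ)))⁻¹) ^ (degreeBound c γ n k + 2)) ≤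
      (n : ℝ) ^ (-(c + 2)) := by
  have hq := one_le_root hn k
  have hq0 : 0 < (n : ℝ) ^ (1 / (k : ℝ)) := by linarith
  have hn0 : (0 : ℝ) < n := by exact_mod_cast (by omega : 0 < n)
  have hn1 : (1 : ℝ) ≤ n := by exact_mod_cast (by omega : 1 ≤ n)
  have hL := half_lt_log hn
  have hk0 : (0 : ℝ) < k := by exact_mod_cast hk
  set q := (n : ℝ) ^ (1 / (k : ℝ)) with hqdef
  set A := degreeBound c γ n k with hA
  have hx0 : 0 ≤ 1 - q⁻¹ := sub_nonneg.2 (inv_le_one_of_one_le₀ hq)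
  have hx1 : 1 - q⁻¹ ≤ Real.log n / k := by
    refine (Real.one_sub_inv_le_log_of_pos hq0).trans (le_of_eq ?_)
    rw [hqdef, Real.log_rpow hn0]
    ring
  have hpow : (1 - q⁻¹) ^ (A + 1) ≤ (n : ℝ) ^ (-(c + 4)) := by
    calc (1 - q⁻¹) ^ (A + 1) ≤ (Real.exp (-q⁻¹)) ^ (A + 1) := by
          gcongr
          exact Real.one_sub_le_exp_neg _
      _ = Real.exp (-(q⁻¹ * ((A : ℝ) + 1))) := by
          rw [← Real.exp_nat_mul]
          push_cast
          ring_nf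
      _ ≤ Real.exp (Real.log n * (-(c + 4))) := by
          refine Real.exp_le_exp.2 ?_
          have h₁ : q⁻¹ * ((6 * γ + c + 4) * q * Real.log n) ≤ q⁻¹ * ((A : ℝ) + 1) :=
            mul_le_mul_of_nonneg_left (le_degreeBound_add_one c γ n k) (by positivity)
          have h₂ : q⁻¹ * ((6 * γ + c + 4) * q * Real.log n) = (6 * γ + c + 4) * Real.log n := by
            field_simp
          nlinarith
      _ = _ := (Real.rpow_def_of_pos hn0 _).symm
  have hJ' : (J : ℝ) ≤ k := by exact_mod_cast (by omega : J ≤ k)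
  have hlog : Real.log n ≤ n := Real.log_le_self hn0.le
  calc (J : ℝ) * (n * (1 - q⁻¹) ^ (A + 2))
      = J * (1 - q⁻¹) * n * (1 - q⁻¹) ^ (A + 1) := by ring
    _ ≤ k * (Real.log n / k) * n * (n : ℝ) ^ (-(c + 4)) := by gcongr
    _ = Real.log n * n * (n : ℝ) ^ (-(c + 4)) := by field_simp
    _ ≤ n * n * (n : ℝ) ^ (-(c + 4)) := by gcongr
    _ = (n : ℝ) ^ (-(c + 2)) := by
        rw [show (-(c + 2)) = 2 + -(c + 4) by ring, Real.rpow_add hn0, Real.rpow_two, sq]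

theorem exp_survivors_le {c γ : ℝ} (hc : 0 < c) (hγ : 1 ≤ γ) {k : ℕ} (hn : 2 ≤ n) (hk : 1 ≤ k) :
    Real.exp (Real.exp 1 * (n * (((n : ℝ) ^ (1 / (k : ℝ)))⁻¹) ^ decomposeStop n γ k) -
      (degreeBound c γ n k + 1 : ℕ)) ≤ (n : ℝ) ^ (-(c + 2)) := by
  have hn0 : (0 : ℝ) < n := by exact_mod_cast (by omega : 0 < n)
  rw [Real.rpow_def_of_pos hn0 (-(c + 2))]
  refine Real.exp_le_exp.2 ?_
  have hq := one_le_root hn k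
  have hL := half_lt_log hn
  have h₁ := mul_inv_pow_decomposeStop_le (γ := γ) hγ hn hk
  have h₂ := le_degreeBound_add_one c γ n k
  have he : Real.exp 1 ≤ 3 := by linarith [Real.exp_one_lt_d9]
  set q := (n : ℝ) ^ (1 / (k : ℝ))
  have hqL : Real.log n ≤ q * Real.log n := by nlinarith
  have h₃ : Real.exp 1 * (n * (q⁻¹) ^ decomposeStop n γ k) ≤ 3 * (2 * γ * q * Real.log n) := by
    gcongr
  push_cast
  nlinarith

/-- With high probability, all clusters have few later neighbors. -/
theorem measure_not_ncard_laterNbrs_le {c γ : ℝ} (hc : 0 < c) (hγ : 1 ≤ γ) {k : ℕ} (hn : 2 ≤ n)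
    (hk : 1 ≤ k) (pick : TieBreak n) (G : SimpleGraph (Fin n)) :
    (Measure.pi fun _ : Fin n => decomposeLaw n k)
      {ω | ¬ ∀ a, (laterNbrs G (decompose γ k pick G ω) a).ncard ≤ degreeBound c γ n k} ≤
      ENNReal.ofReal ((n : ℝ) ^ (-(c + 1))) := by
  set A := degreeBound c γ n k with hA
  set J := decomposeStop n γ k with hJdef
  have hJ : J ≤ k - 1 := stopLevel_le _ _ _ _
  have hn0 : (0 : ℝ) < n := by exact_mod_cast (by omega : 0 < n)
  have hx0 : 0 ≤ 1 - ((n : ℝ) ^ (1 / (k : ℝ)))⁻¹ :=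
    sub_nonneg.2 (inv_le_one_of_one_le₀ (one_le_root hn k))
  have hsub : {ω : Fin n → DecomposeCoin k |
      ¬ ∀ a, (laterNbrs G (decompose γ k pick G ω) a).ncard ≤ A} ⊆
      (⋃ j ∈ Finset.range J, ⋃ a ∈ (Finset.univ : Finset (Fin n)),
        {ω | levelLeader pick G (levelCoins ω) j a = none ∧
          A < {b | (levelGraph pick G (levelCoins ω) j).Adj a b}.ncard}) ∪
      {ω | A + 1 ≤ {b | ∀ i < J, levelCoins ω i b = true}.ncard} := by
    intro ω hω
    by_contra hnot
    rw [Set.mem_union, not_or] at hnot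
    obtain ⟨h₁, h₂⟩ := hnot
    apply hω
    rw [decompose_eq_run]
    refine ncard_laterNbrs_le J (fun i hi a hnone => ?_) (by simpa [Nat.lt_succ_iff] using h₂)
    by_contra hlt
    exact h₁ (Set.mem_biUnion (x := i) (by simpa using hi)
      (Set.mem_biUnion (x := a) (by simp) ⟨hnone, not_le.1 hlt⟩))
  calc _ ≤ _ := measure_mono hsub
    _ ≤ _ := measure_union_le _ _
    _ ≤ ENNReal.ofReal ((n : ℝ) ^ (-(c + 2))) + ENNReal.ofReal ((n : ℝ) ^ (-(c + 2))) := by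
        refine add_le_add ?_ ?_
        · calc _ ≤ ∑ j ∈ Finset.range J, ∑ a ∈ (Finset.univ : Finset (Fin n)), ENNReal.ofReal
                ((1 - ((n : ℝ) ^ (1 / (k : ℝ)))⁻¹) ^ (A + 2)) := by
                refine (measure_biUnion_finset_le _ _).trans (Finset.sum_le_sum fun j hj => ?_)
                refine (measure_biUnion_finset_le _ _).trans (Finset.sum_le_sum fun a _ => ?_)
                exact measure_undominated_le pick G k A j
                  (lt_of_lt_of_le (Finset.mem_range.1 hj) hJ) a
            _ = ENNReal.ofReal ((J : ℝ) *
                (n * (1 - ((n : ℝ) ^ (1 / (k : ℝ)))⁻¹) ^ (A + 2))) := by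
                rw [ENNReal.ofReal_mul (Nat.cast_nonneg _), ENNReal.ofReal_mul (Nat.cast_nonneg _)]
                simp
            _ ≤ _ := ENNReal.ofReal_le_ofReal (sum_undominated_le hc hγ hn hk hJ)
        · exact (measure_survivors_le k J (A + 1) hJ).trans
            (ENNReal.ofReal_le_ofReal (exp_survivors_le hc hγ hn hk))
    _ = ENNReal.ofReal (2 * (n : ℝ) ^ (-(c + 2))) := by
        rw [← ENNReal.ofReal_add (by positivity) (by positivity), two_mul]
    _ ≤ _ := by
        refine ENNReal.ofReal_le_ofReal ?_
        rw [show (-(c + 1)) = 1 + -(c + 2) by ring, Real.rpow_add hn0, Real.rpow_one]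
        gcongr
        exact_mod_cast hn

end Bound

/-! ### Labels computed from additional coins -/

section Labels

variable {n : ℕ}

/-- The law of the coins of a vertex: those of Procedure Decompose and, independently, a uniformly
random sequence of `M` colors. -/
def labelLaw (n k M P : ℕ) : Measure (DecomposeCoin k × (Fin M → Fin (P + 1))) :=
  (decomposeLaw n k).prod (ProbabilityTheory.uniformOn Set.univ)

instance (n k M P : ℕ) : IsProbabilityMeasure (labelLaw n k M P) := by
  unfold labelLaw
  infer_instance

theorem measurePreserving_fst_labelLaw (n k M P : ℕ) :
    MeasurePreserving Prod.fst (labelLaw n k M P) (decomposeLaw n k) :=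
  measurePreserving_fst

/-- An event concerning the vertex `a` is unlikely if it is unlikely over the choice of the random
colors of `a`, all the other coins being fixed. -/
theorem measure_labelLaw_le {k M P : ℕ} (a : Fin n)
    (E : (Fin n → DecomposeCoin k) → (Fin n → Fin M → Fin (P + 1)) → Prop) (ε : ℝ≥0∞)
    (h : ∀ ω x, ProbabilityTheory.uniformOn Set.univ {z | E ω (Function.update x a z)} ≤ ε) :
    (Measure.pi fun _ : Fin n => labelLaw n k M P)
      {W | E (fun u => (W u).1) (fun u => (W u).2)} ≤ ε := by
  have hmp := measurePreserving_arrowProdEquivProdArrow (DecomposeCoin k) (Fin M → Fin (P + 1))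
    (Fin n) (fun _ => decomposeLaw n k) (fun _ => ProbabilityTheory.uniformOn Set.univ)
  have hpre := hmp.measure_preimage (s := {y | E y.1 y.2})
    (MeasurableSet.of_discrete).nullMeasurableSet
  refine (le_of_eq hpre).trans ?_
  rw [Measure.prod_apply MeasurableSet.of_discrete]
  calc ∫⁻ ω, (Measure.pi fun _ : Fin n => ProbabilityTheory.uniformOn Set.univ)
        (Prod.mk ω ⁻¹' {y | E y.1 y.2}) ∂(Measure.pi fun _ : Fin n => decomposeLaw n k)
      ≤ ∫⁻ _, ε ∂(Measure.pi fun _ : Fin n => decomposeLaw n k) :=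
        lintegral_mono fun ω => measure_pi_le_of_update _ MeasurableSet.of_discrete a ε (h ω)
    _ = ε := by simp

theorem decompose_leader {γ : ℝ} {k : ℕ} {pick : TieBreak n} {G : SimpleGraph (Fin n)}
    (ω : Fin n → DecomposeCoin k) (v : Fin n) :
    decompose γ k pick G ω (decompose γ k pick G ω v).1 = decompose γ k pick G ω v := by
  rw [decompose_eq_run]
  exact run_leader _ v

theorem decomposeStop_le (n : ℕ) (γ : ℝ) (k : ℕ) : decomposeStop n γ k ≤ k - 1 :=
  stopLevel_le _ _ _ _

theorem isGoodDecomposition_decompose {c γ C : ℝ} {k : ℕ} {pick : TieBreak n}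
    {G : SimpleGraph (Fin n)} {ω : Fin n → DecomposeCoin k} (hk : 1 ≤ k)
    (hA : ∀ a, (laterNbrs G (decompose γ k pick G ω) a).ncard ≤ degreeBound c γ n k)
    (hAC : degreeBound c γ n k + 1 ≤ ⌊C * (n : ℝ) ^ (1 / (k : ℝ)) * Real.log n⌋₊) :
    IsGoodDecomposition C k G (decompose γ k pick G ω) := by
  rw [decompose_eq_run] at hA ⊢
  exact isGoodDecomposition_run hk (decomposeStop_le n γ k) hA hAC

theorem isLocal_decompose (γ : ℝ) (k : ℕ) (pick : TieBreak n) :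
    IsLocal (2 * 3 ^ (k - 1)) fun G (ω : Fin n → DecomposeCoin k) v =>
      decompose γ k pick G ω v := by
  simp only [decompose_eq_run]
  exact (isLocal_run pick k (decomposeStop n γ k)).mono
    (Nat.mul_le_mul_left 2 (Nat.pow_le_pow_right (by norm_num) (decomposeStop_le n γ k)))

theorem exists_walk_decompose (γ : ℝ) (k : ℕ) (pick : TieBreak n) (G : SimpleGraph (Fin n))
    (ω : Fin n → DecomposeCoin k) (v : Fin n) :
    ∃ p : G.Walk v (decompose γ k pick G ω v).1, p.length ≤ 3 ^ (k - 1) - 1 := by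
  rw [decompose_eq_run]
  obtain ⟨p, hp⟩ := exists_walk_leader (G := G) pick (levelCoins ω) (decomposeStop n γ k) v
  have : 3 ^ decomposeStop n γ k ≤ 3 ^ (k - 1) :=
    Nat.pow_le_pow_right (by norm_num) (decomposeStop_le n γ k)
  exact ⟨p, by omega⟩

/-- One round on the supergraph: a leader learns the values at the leaders of the clusters adjacent
to its own in at most `2 * 3 ^ (k - 1)` rounds. -/
theorem isLocal_laterNbrs {Coin X : Type*} {γ : ℝ} {k : ℕ} {pick : TieBreak n}
    (π : Coin → DecomposeCoin k) {r : ℕ} (hr : 2 * 3 ^ (k - 1) ≤ r)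
    {D : SimpleGraph (Fin n) → (Fin n → Coin) → Fin n → X} (hD : IsLocal r D) :
    IsLocal (r + 2 * 3 ^ (k - 1)) fun G ω a => {y : Fin n × X |
      y.1 ∈ laterNbrs G (decompose γ k pick G fun u => π (ω u)) a ∧ y.2 = D G ω y.1} := by
  have hpos : 1 ≤ 3 ^ (k - 1) := Nat.one_le_pow _ _ (by norm_num)
  have hout := (isLocal_decompose γ k pick).comap π
  have hℓ := hout.comp Prod.fst
  have hd : ∀ (G : SimpleGraph (Fin n)) (ω : Fin n → Coin) v,
      ∃ p : G.Walk v (decompose γ k pick G (fun u => π (ω u)) v).1, p.length ≤ 3 ^ (k - 1) - 1 :=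
    fun G ω v => exists_walk_decompose γ k pick G _ v
  have hDℓ := hℓ.eval (t := r + 3 ^ (k - 1) - 1) hD hd (by omega) (by omega)
  have hE := IsLocal.boundary (t := r + 2 * 3 ^ (k - 1)) (hℓ.mono (by omega))
    ((hout.mono (s := r + 3 ^ (k - 1) - 1) (by omega)).prodMk hDℓ) hd (by omega)
  have h := (hE.prodMk (F' := fun _ _ a => a) fun _ _ _ _ _ _ => rfl).comp fun e =>
    {y : Fin n × X | e.2 ≠ y.1 ∧ ∃ z ∈ e.1, z.1.1.2 ≤ z.2.1.2 ∧ z.2.1.1 = y.1 ∧ y.2 = z.2.2}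
  convert h using 4 with G ω a
  ext ⟨b, d⟩
  constructor
  · rintro ⟨⟨hab, u, w, hu, rfl, huw, hl⟩, hd'⟩
    exact ⟨hab, _, ⟨u, w, hu, huw, rfl⟩, hl, rfl, hd'⟩
  · rintro ⟨hab, _, ⟨u, w, hu, huw, rfl⟩, hl, rfl, hd'⟩
    exact ⟨⟨hab, u, w, hu, rfl, huw, hl⟩, hd'⟩

/-- Labels for the clusters are obtained from a local rule for the colors of the leaders, if each
leader fails only with small probability over its own random colors, and if the rule
gives a proper coloring when no leader fails. -/
theorem exists_computesWithLabels {c γ C : ℝ} (hc : 0 < c) (hγ : 1 ≤ γ) {k : ℕ} (hn : 2 ≤ n)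
    (hk : 1 ≤ k) (pick : TieBreak n) {M P p r : ℕ}
    (col : SimpleGraph (Fin n) → (Fin n → DecomposeCoin k × (Fin M → Fin (P + 1))) → Fin n → ℕ)
    (fail : SimpleGraph (Fin n) → (Fin n → DecomposeCoin k) → (Fin n → Fin M → Fin (P + 1)) →
      Fin n → Prop)
    (hr : 2 * 3 ^ (k - 1) ≤ r) (hlocal : IsLocal r col)
    (hAC : degreeBound c γ n k + 1 ≤ ⌊C * (n : ℝ) ^ (1 / (k : ℝ)) * Real.log n⌋₊)
    (hfail : ∀ G ω x a, (laterNbrs G (decompose γ k pick G ω) a).ncard ≤ degreeBound c γ n k →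
      ProbabilityTheory.uniformOn Set.univ {z | fail G ω (Function.update x a z) a} ≤
        ENNReal.ofReal ((n : ℝ) ^ (-(c + 2))))
    (hp : ∀ G W a, col G W a < p)
    (hcol : ∀ G W, (∀ a, ¬ fail G (fun u => (W u).1) (fun u => (W u).2) a) → ∀ a b,
      b ∈ laterNbrs G (decompose γ k pick G fun u => (W u).1) a → col G W a ≠ col G W b) :
    ∃ A : DistAlg n ((Fin n × ℕ) × ℕ),
      ComputesWithLabels A (r + 3 ^ (k - 1)) c γ C k p pick := by
  have hpos : 1 ≤ 3 ^ (k - 1) := Nat.one_le_pow _ _ (by norm_num)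
  have hn0 : (0 : ℝ) < n := by exact_mod_cast (by omega : 0 < n)
  have hout := (isLocal_decompose γ k pick).comap
    (Prod.fst : DecomposeCoin k × (Fin M → Fin (P + 1)) → DecomposeCoin k)
  have hlab := (hout.comp Prod.fst).eval (t := r + 3 ^ (k - 1) - 1) hlocal
    (fun G W v => exists_walk_decompose γ k pick G _ v) (by omega) (by omega)
  have hF := (hout.mono (s := r + 3 ^ (k - 1) - 1) (by omega)).prodMk hlab
  refine ⟨gatherAlg (labelLaw n k M P) (r + 3 ^ (k - 1)) fun G
    (W : Fin n → DecomposeCoin k × (Fin M → Fin (P + 1))) v =>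
      (decompose γ k pick G (fun u => (W u).1) v,
        col G W (decompose γ k pick G (fun u => (W u).1) v).1), Prod.fst,
    measurePreserving_fst_labelLaw n k M P, fun G => ⟨fun W v =>
      col G W (decompose γ k pick G (fun u => (W u).1) v).1, fun W => ?_, ?_⟩⟩
  · have h := gatherAlg_outputsWithin (labelLaw n k M P) hF G W
    rwa [show r + 3 ^ (k - 1) - 1 + 1 = r + 3 ^ (k - 1) by omega] at h
  · set A := degreeBound c γ n k with hA
    have hsub : {W : Fin n → DecomposeCoin k × (Fin M → Fin (P + 1)) |
        ¬ (IsGoodDecomposition C k G (decompose γ k pick G fun u => (W u).1) ∧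
          IsLabeling G (clusters (decompose γ k pick G fun u => (W u).1)) p fun v =>
            col G W (decompose γ k pick G (fun u => (W u).1) v).1)} ⊆
        {W | ¬ ∀ a, (laterNbrs G (decompose γ k pick G fun u => (W u).1) a).ncard ≤ A} ∪
        ⋃ a ∈ (Finset.univ : Finset (Fin n)),
          {W | (laterNbrs G (decompose γ k pick G fun u => (W u).1) a).ncard ≤ A ∧
            fail G (fun u => (W u).1) (fun u => (W u).2) a} := by
      intro W hW
      by_contra hnot
      rw [Set.mem_union, not_or] at hnot
      obtain ⟨h₁, h₂⟩ := hnot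
      have h₁' : ∀ a, (laterNbrs G (decompose γ k pick G fun u => (W u).1) a).ncard ≤ A :=
        not_not.1 h₁
      have h₂' : ∀ a, ¬ fail G (fun u => (W u).1) (fun u => (W u).2) a := fun a ha =>
        h₂ (Set.mem_biUnion (x := a) (by simp) ⟨h₁' a, ha⟩)
      refine hW ⟨isGoodDecomposition_decompose hk h₁' hAC, isLabeling_of_color _
        (fun v => hp G W _) fun u w huw hne => ?_⟩
      rcases le_total (decompose γ k pick G (fun u => (W u).1) u).2
        (decompose γ k pick G (fun u => (W u).1) w).2 with hl | hl
      · exact hcol G W h₂' _ _ ⟨hne, u, w, rfl, rfl, huw, hl⟩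
      · exact (hcol G W h₂' _ _ ⟨hne.symm, w, u, rfl, rfl, huw.symm, hl⟩).symm
    have hfst := measurePreserving_pi (fun _ : Fin n => labelLaw n k M P)
      (fun _ : Fin n => decomposeLaw n k) (fun _ => measurePreserving_fst_labelLaw n k M P)
    have hbad := hfst.measure_preimage (s := {ω | ¬ ∀ a,
      (laterNbrs G (decompose γ k pick G ω) a).ncard ≤ A})
      (MeasurableSet.of_discrete).nullMeasurableSet
    calc _ ≤ _ := measure_mono hsub
      _ ≤ _ := measure_union_le _ _
      _ ≤ ENNReal.ofReal ((n : ℝ) ^ (-(c + 1))) + ENNReal.ofReal ((n : ℝ) ^ (-(c + 1))) := by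
          refine add_le_add ?_ ?_
          · exact (le_of_eq hbad).trans (measure_not_ncard_laterNbrs_le hc hγ hn hk pick G)
          · calc _ ≤ ∑ a ∈ (Finset.univ : Finset (Fin n)),
                  ENNReal.ofReal ((n : ℝ) ^ (-(c + 2))) := by
                  refine (measure_biUnion_finset_le _ _).trans (Finset.sum_le_sum fun a _ => ?_)
                  refine measure_labelLaw_le a (fun ω x =>
                    (laterNbrs G (decompose γ k pick G ω) a).ncard ≤ A ∧ fail G ω x a) _
                    fun ω x => ?_
                  by_cases hle : (laterNbrs G (decompose γ k pick G ω) a).ncard ≤ A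
                  · simpa only [hle, true_and] using hfail G ω x a hle
                  · simp [hle]
              _ = ENNReal.ofReal ((n : ℝ) ^ (-(c + 1))) := by
                  rw [show (-(c + 1)) = 1 + -(c + 2) by ring, Real.rpow_add hn0, Real.rpow_one,
                    ENNReal.ofReal_mul (Nat.cast_nonneg _)]
                  simp
      _ = ENNReal.ofReal (2 * (n : ℝ) ^ (-(c + 1))) := by
          rw [← ENNReal.ofReal_add (by positivity) (by positivity), two_mul]
      _ ≤ _ := by
          refine ENNReal.ofReal_le_ofReal ?_
          rw [show (-c) = 1 + -(c + 1) by ring, Real.rpow_add hn0, Real.rpow_one]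
          gcongr
          exact_mod_cast hn

end Labels

/-! ### Labels from a single round of random lists of colors -/

section OneShot

/-- The probability that a random sequence of colors hits a forbidden color at all the
positions in `W`, if the at most `A` forbidden colors at a position depend only on the colors
at the earlier positions. -/
theorem uniformOn_forall_mem_le {M P A r : ℕ} (W : Finset (Fin M)) (hW : r ≤ W.card)
    (F : Fin M → (Fin M → Fin (P + 1)) → Finset (Fin (P + 1)))
    (hF : ∀ τ x y, (∀ i < τ, x i = y i) → F τ x = F τ y) (hA : ∀ τ ∈ W, ∀ x, (F τ x).card ≤ A)
    {ρ : ℝ} (hρ0 : 0 ≤ ρ) (hρ1 : ρ ≤ 1) (hρ : (A : ℝ) ≤ ρ * (P + 1 : ℕ)) :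
    ProbabilityTheory.uniformOn Set.univ {z : Fin M → Fin (P + 1) | ∀ τ ∈ W, z τ ∈ F τ z} ≤
      ENNReal.ofReal (ρ ^ r) := by
  classical
  have hP : (0 : ℝ) < (P + 1 : ℕ) := by positivity
  let F' : Fin M → (Fin M → Fin (P + 1)) → Finset (Fin (P + 1)) :=
    fun τ z => if τ ∈ W then F τ z else Finset.univ
  have hset : {z : Fin M → Fin (P + 1) | ∀ τ ∈ W, z τ ∈ F τ z} = {z | ∀ τ, z τ ∈ F' τ z} := by
    ext z
    refine forall_congr' fun τ => ?_
    by_cases hτ : τ ∈ W <;> simp [F', hτ]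
  have hcard := ncard_forall_mem_le F' (fun τ => if τ ∈ W then A else P + 1)
    (fun τ x y hxy => by simp only [F', hF τ x y hxy]) (fun τ x => by
      by_cases hτ : τ ∈ W
      · simpa [F', hτ] using hA τ hτ x
      · simp [F', hτ])
  rw [hset]
  refine (uniformOn_univ_le hcard).trans ?_
  have hpow : (Fintype.card (Fin M → Fin (P + 1)) : ℝ) = ∏ _τ : Fin M, ((P + 1 : ℕ) : ℝ) := by
    simp
  rw [← ENNReal.ofReal_natCast, ← ENNReal.ofReal_natCast (Fintype.card _),
    ← ENNReal.ofReal_div_of_pos (by rw [hpow]; positivity)]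
  refine ENNReal.ofReal_le_ofReal ?_
  rw [hpow, Nat.cast_prod, ← Finset.prod_div_distrib]
  calc ∏ τ : Fin M, (((if τ ∈ W then A else P + 1 : ℕ) : ℝ) / (P + 1 : ℕ))
      ≤ ∏ τ : Fin M, (if τ ∈ W then ρ else 1) := by
        refine Finset.prod_le_prod (fun τ _ => by positivity) fun τ _ => ?_
        split_ifs
        · rwa [div_le_iff₀ hP]
        · rw [div_self hP.ne']
    _ = ρ ^ W.card := by rw [Finset.prod_ite_mem, Finset.univ_inter, Finset.prod_const]
    _ ≤ ρ ^ r := pow_le_pow_of_le_one hρ0 hρ1 hW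

open scoped Classical in
/-- The label of a cluster with the random colors `x`, where `N` contains the random colors of the
later neighbors: the first position at which `x` differs from all of them, together with the color
there. -/
def listColor {M P : ℕ} (x : Fin M → Fin (P + 1)) (N : Set (Fin M → Fin (P + 1))) : ℕ :=
  if h : ∃ τ, ∀ y ∈ N, x τ ≠ y τ then (finProdFinEquiv (h.choose, x h.choose) : ℕ) else 0

theorem listColor_lt {M P : ℕ} (hM : 0 < M) (x : Fin M → Fin (P + 1))
    (N : Set (Fin M → Fin (P + 1))) : listColor x N < M * (P + 1) := by
  unfold listColor
  split_ifs with h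
  · exact Fin.is_lt _
  · positivity

theorem listColor_ne {M P : ℕ} {x y : Fin M → Fin (P + 1)} {N N' : Set (Fin M → Fin (P + 1))}
    (hx : ∃ τ, ∀ z ∈ N, x τ ≠ z τ) (hy : ∃ τ, ∀ z ∈ N', y τ ≠ z τ) (hyN : y ∈ N) :
    listColor x N ≠ listColor y N' := by
  unfold listColor
  rw [dif_pos hx, dif_pos hy]
  intro heq
  have h := finProdFinEquiv.injective (Fin.ext heq)
  rw [Prod.mk.injEq] at h
  refine hx.choose_spec y hyN ?_
  rw [h.2, h.1]

variable {n : ℕ}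

theorem exists_computesWithLabels_of_lists {c γ C : ℝ} (hc : 0 < c) (hγ : 1 ≤ γ) {k : ℕ}
    (hn : 2 ≤ n) (hk : 1 ≤ k) (pick : TieBreak n) {p : ℕ}
    (hAC : degreeBound c γ n k + 1 ≤ ⌊C * (n : ℝ) ^ (1 / (k : ℝ)) * Real.log n⌋₊)
    (hp : ⌈(c + 2) * Real.log n⌉₊ * (3 * degreeBound c γ n k + 1) ≤ p) :
    ∃ A : DistAlg n ((Fin n × ℕ) × ℕ),
      ComputesWithLabels A (5 * 3 ^ (k - 1)) c γ C k p pick := by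
  classical
  have hn0 : (0 : ℝ) < n := by exact_mod_cast (by omega : 0 < n)
  have hL := half_lt_log hn
  set A := degreeBound c γ n k with hA
  set M := ⌈(c + 2) * Real.log n⌉₊ with hM
  have hM0 : 0 < M := Nat.ceil_pos.2 (by positivity)
  have hlocal := (((isLocal_coin (n := n) (2 * 3 ^ (k - 1) + 2 * 3 ^ (k - 1))
    (Prod.snd : DecomposeCoin k × (Fin M → Fin (3 * A + 1)) → _)).prodMk
    (isLocal_laterNbrs (γ := γ) (pick := pick)
      (Prod.fst : DecomposeCoin k × (Fin M → Fin (3 * A + 1)) → _) le_rfl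
      (isLocal_coin (n := n) (2 * 3 ^ (k - 1))
        (Prod.snd : DecomposeCoin k × (Fin M → Fin (3 * A + 1)) → _)))).comp
    fun z => listColor z.1 (Prod.snd '' z.2))
  rw [show 5 * 3 ^ (k - 1) = 2 * 3 ^ (k - 1) + 2 * 3 ^ (k - 1) + 3 ^ (k - 1) by ring]
  refine exists_computesWithLabels hc hγ hn hk pick _
    (fun G ω x a => ∀ τ, ∃ b ∈ laterNbrs G (decompose γ k pick G ω) a, x a τ = x b τ)
    (by omega) hlocal hAC ?_ (fun G W a => (listColor_lt hM0 _ _).trans_le hp) ?_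
  · intro G ω x a hle
    have hfin := Set.toFinite (laterNbrs G (decompose γ k pick G ω) a)
    refine le_trans (measure_mono ?_) ((uniformOn_forall_mem_le (A := A) Finset.univ
      (r := M) (by simp) (fun τ _ => hfin.toFinset.image fun b => x b τ) (fun _ _ _ _ => rfl)
      (fun τ _ _ => ?_) (ρ := 1 / 3) (by norm_num) (by norm_num) ?_).trans
      (ENNReal.ofReal_le_ofReal ?_))
    · intro z hz τ _
      obtain ⟨b, hb, heq⟩ := hz τ
      rw [Function.update_self, Function.update_of_ne (Ne.symm hb.1)] at heq
      exact Finset.mem_image.2 ⟨b, hfin.mem_toFinset.2 hb, heq.symm⟩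
    · refine Finset.card_image_le.trans ?_
      rwa [← Set.ncard_eq_toFinset_card]
    · push_cast
      linarith
    · have he : (1 / 3 : ℝ) ≤ Real.exp (-1) := by
        rw [Real.exp_neg, one_div]
        exact inv_anti₀ (Real.exp_pos 1) (by linarith [Real.exp_one_lt_d9])
      calc (1 / 3 : ℝ) ^ M ≤ (Real.exp (-1)) ^ M := by gcongr
        _ = Real.exp (-M) := by rw [← Real.exp_nat_mul]; ring_nf
        _ ≤ Real.exp (Real.log n * (-(c + 2))) := by
            refine Real.exp_le_exp.2 ?_
            have := Nat.le_ceil ((c + 2) * Real.log n)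
            rw [← hM] at this
            linarith
        _ = _ := (Real.rpow_def_of_pos hn0 _).symm
  · intro G W hW a b hb
    have hex : ∀ a, ∃ τ, ∀ y ∈ Prod.snd '' {y : Fin n × (Fin M → Fin (3 * A + 1)) |
        y.1 ∈ laterNbrs G (decompose γ k pick G fun u => (W u).1) a ∧ y.2 = (W y.1).2},
        (W a).2 τ ≠ y τ := by
      intro a
      have h := hW a
      push Not at h
      obtain ⟨τ, hτ⟩ := h
      refine ⟨τ, ?_⟩
      rintro _ ⟨y, ⟨hb, hy⟩, rfl⟩
      rw [hy]
      exact hτ _ hb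
    exact listColor_ne (hex a) (hex b) ⟨(b, (W b).2), ⟨hb, rfl⟩, rfl⟩

end OneShot

/-! ### Labels from random trials, one set `S_i` after the other -/

section Trials

variable {n : ℕ} {α : Type*}

open scoped Classical in
/-- One trial of a cluster that tries the color `own`: `cur` is the color that it already has, if
any, and `N` holds, for each later neighbor, the color that it already has and the color that
it tries. -/
def trialStep (cur : Option α) (active : Prop) (own : α) (N : Set (Option α × α)) : Option α :=
  if cur = none ∧ active ∧ ∀ y ∈ N, own ≠ y.1.getD y.2 then some own else cur

/-- The colors after `τ` trials.  In the trial `τ`, the uncolored clusters of the set `S_i` with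
`i = act τ` try the colors `x · τ`.  A cluster keeps its color if
it differs from the colors that the later neighbors have, or try if they have none. -/
def trialColor (G : SimpleGraph (Fin n)) (out : Fin n → Fin n × ℕ) (act : ℕ → ℕ)
    (x : Fin n → ℕ → α) : ℕ → Fin n → Option α
  | 0, _ => none
  | τ + 1, a => trialStep (trialColor G out act x τ a) ((out a).2 = act τ) (x a τ)
      ((fun b => (trialColor G out act x τ b, x b τ)) '' laterNbrs G out a)

variable {G : SimpleGraph (Fin n)} {out : Fin n → Fin n × ℕ} {act : ℕ → ℕ} {x : Fin n → ℕ → α}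

theorem trialColor_congr {x' : Fin n → ℕ → α} {τ : ℕ} (h : ∀ a, ∀ i < τ, x a i = x' a i) :
    trialColor G out act x τ = trialColor G out act x' τ := by
  induction τ with
  | zero => rfl
  | succ τ ih =>
    have ih' := ih fun a i hi => h a i (by omega)
    funext a
    simp only [trialColor, ih', h _ τ (Nat.lt_succ_self τ)]

theorem trialColor_succ_of_eq_some {τ : ℕ} {a : Fin n} {y : α}
    (h : trialColor G out act x τ a = some y) : trialColor G out act x (τ + 1) a = some y := by
  rw [trialColor, trialStep, h, if_neg (by simp)]

theorem trialColor_eq_none_of_le {τ σ : ℕ} (h : τ ≤ σ) {a : Fin n}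
    (hσ : trialColor G out act x σ a = none) : trialColor G out act x τ a = none := by
  induction σ, h using Nat.le_induction with
  | base => exact hσ
  | succ σ _ ih =>
    refine ih ?_
    by_contra hne
    obtain ⟨y, hy⟩ := Option.ne_none_iff_exists'.1 hne
    rw [trialColor_succ_of_eq_some hy] at hσ
    exact absurd hσ (by simp)

/-- A color appears at a trial of the set that contains the cluster, and differs from the colors of
the later neighbors in this trial. -/
theorem trialColor_of_new {τ : ℕ} {a : Fin n} {y : α} (h : trialColor G out act x τ a = none)
    (h' : trialColor G out act x (τ + 1) a = some y) :
    (out a).2 = act τ ∧ y = x a τ ∧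
      ∀ b ∈ laterNbrs G out a, y ≠ (trialColor G out act x τ b).getD (x b τ) := by
  rw [trialColor, trialStep] at h'
  split_ifs at h' with hc
  · cases h'
    exact ⟨hc.2.1, rfl, fun b hb => hc.2.2 _ ⟨b, hb, rfl⟩⟩
  · rw [h] at h'
    exact absurd h' (by simp)

/-- The sets are colored in descending order. -/
theorem act_le_of_trialColor (hact : Antitone act) {τ : ℕ} {a : Fin n} {y : α}
    (h : trialColor G out act x τ a = some y) : act τ ≤ (out a).2 := by
  induction τ generalizing y with
  | zero => simp [trialColor] at h
  | succ τ ih =>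
    refine (hact (Nat.le_succ τ)).trans ?_
    cases h' : trialColor G out act x τ a with
    | none => exact (trialColor_of_new h' h).1.ge
    | some z => exact ih h'

theorem mem_laterNbrs_symm (hout : ∀ v, out (out v).1 = out v) {a b : Fin n}
    (h : b ∈ laterNbrs G out a) (hl : (out b).2 ≤ (out a).2) : a ∈ laterNbrs G out b := by
  obtain ⟨hab, u, w, rfl, rfl, huw, -⟩ := h
  rw [hout, hout] at hl
  exact ⟨hab.symm, w, u, rfl, rfl, huw.symm, hl⟩

theorem trialColor_ne (hact : Antitone act) (hout : ∀ v, out (out v).1 = out v) {τ : ℕ}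
    {a b : Fin n} {y z : α} (hb : b ∈ laterNbrs G out a)
    (hy : trialColor G out act x τ a = some y) (hz : trialColor G out act x τ b = some z) :
    y ≠ z := by
  induction τ generalizing y z with
  | zero => simp [trialColor] at hy
  | succ τ ih =>
    cases ha' : trialColor G out act x τ a with
    | none =>
      have h := (trialColor_of_new ha' hy).2.2 b hb
      cases hb' : trialColor G out act x τ b with
      | none =>
        rw [hb', Option.getD_none] at h
        rwa [(trialColor_of_new hb' hz).2.1]
      | some z' =>
        rw [hb', Option.getD_some] at h
        rw [trialColor_succ_of_eq_some hb'] at hz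
        cases hz
        exact h
    | some y' =>
      rw [trialColor_succ_of_eq_some ha'] at hy
      cases hy
      cases hb' : trialColor G out act x τ b with
      | none =>
        -- `b` is colored after `a`, so both belong to the same set
        have h := trialColor_of_new hb' hz
        have hl : (out b).2 ≤ (out a).2 := h.1.trans_le (act_le_of_trialColor hact ha')
        have hne := h.2.2 a (mem_laterNbrs_symm hout hb hl)
        rw [ha', Option.getD_some] at hne
        exact hne.symm
      | some z' =>
        rw [trialColor_succ_of_eq_some hb'] at hz
        cases hz
        exact ih ha' hb'

/-- A finite sequence of random colors, continued arbitrarily. -/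
def extendSeq {M P : ℕ} (z : Fin M → Fin (P + 1)) (τ : ℕ) : Fin (P + 1) :=
  if h : τ < M then z ⟨τ, h⟩ else 0

theorem extendSeq_congr {M P : ℕ} {z z' : Fin M → Fin (P + 1)} {τ : ℕ}
    (h : ∀ i : Fin M, (i : ℕ) = τ → z i = z' i) : extendSeq z τ = extendSeq z' τ := by
  unfold extendSeq
  split_ifs with hτ
  · exact h _ rfl
  · rfl

/-- In each of the at least `r` trials of its set, a cluster fails with probability at most `ρ`. -/
theorem uniformOn_trialColor_eq_none_le {M P A r : ℕ} (act : ℕ → ℕ)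
    (out : Fin n → Fin n × ℕ) (x : Fin n → Fin M → Fin (P + 1)) (a : Fin n)
    (hr : r ≤ (Finset.univ.filter fun τ : Fin M => (out a).2 = act τ).card)
    (hA : (laterNbrs G out a).ncard ≤ A)
    {ρ : ℝ} (hρ0 : 0 ≤ ρ) (hρ1 : ρ ≤ 1) (hρ : (A : ℝ) ≤ ρ * (P + 1 : ℕ)) :
    ProbabilityTheory.uniformOn Set.univ {z | trialColor G out act
      (fun b => extendSeq (Function.update x a z b)) M a = none} ≤ ENNReal.ofReal (ρ ^ r) := by
  classical
  have hfin := Set.toFinite (laterNbrs G out a)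
  refine le_trans (measure_mono ?_) (uniformOn_forall_mem_le (A := A) _ hr
    (fun τ z => hfin.toFinset.image fun b =>
      (trialColor G out act (fun b => extendSeq (Function.update x a z b)) τ b).getD (x b τ))
    ?_ (fun τ _ z => ?_) hρ0 hρ1 hρ)
  · intro z hz τ hτ
    have h₀ : trialColor G out act (fun b => extendSeq (Function.update x a z b)) τ a = none :=
      trialColor_eq_none_of_le τ.2.le hz
    have h₁ : trialColor G out act (fun b => extendSeq (Function.update x a z b)) (τ + 1) a =
        none := trialColor_eq_none_of_le τ.2 hz
    rw [trialColor, trialStep, h₀] at h₁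
    by_contra hnot
    rw [if_pos] at h₁
    · exact absurd h₁ (by simp)
    refine ⟨rfl, (Finset.mem_filter.1 hτ).2, ?_⟩
    rintro _ ⟨b, hb, rfl⟩ heq
    refine hnot (Finset.mem_image.2 ⟨b, hfin.mem_toFinset.2 hb, ?_⟩)
    simp only [extendSeq, τ.2, dif_pos, Function.update_self, Fin.eta,
      Function.update_of_ne (Ne.symm hb.1)] at heq
    exact heq.symm
  · intro τ z z' hzz'
    have h : trialColor G out act (fun b => extendSeq (Function.update x a z b)) τ =
        trialColor G out act (fun b => extendSeq (Function.update x a z' b)) τ := by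
      refine trialColor_congr fun b i hi => extendSeq_congr fun i' hi' => ?_
      by_cases hb : b = a
      · subst hb
        rw [Function.update_self, Function.update_self]
        exact hzz' i' (by rw [Fin.lt_def, hi']; exact hi)
      · rw [Function.update_of_ne hb, Function.update_of_ne hb]
    simp only [h]
  · refine Finset.card_image_le.trans ?_
    rwa [← Set.ncard_eq_toFinset_card]

theorem isLocal_trialColor {M P : ℕ} (γ : ℝ) (k : ℕ) (pick : TieBreak n) (act : ℕ → ℕ) (τ : ℕ) :
    IsLocal (2 * 3 ^ (k - 1) + τ * (2 * 3 ^ (k - 1)))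
      fun G (W : Fin n → DecomposeCoin k × (Fin M → Fin (P + 1))) a =>
        trialColor G (decompose γ k pick G fun u => (W u).1) act
          (fun b => extendSeq (W b).2) τ a := by
  induction τ with
  | zero => exact fun _ _ _ _ _ _ => rfl
  | succ τ ih =>
    have hout := (isLocal_decompose γ k pick).comap
      (Prod.fst : DecomposeCoin k × (Fin M → Fin (P + 1)) → DecomposeCoin k)
    have hcoin := fun r => isLocal_coin (n := n) r
      fun W : DecomposeCoin k × (Fin M → Fin (P + 1)) => extendSeq W.2 τ
    have hN := isLocal_laterNbrs (γ := γ) (pick := pick)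
      (Prod.fst : DecomposeCoin k × (Fin M → Fin (P + 1)) → DecomposeCoin k)
      (by omega) (ih.prodMk (hcoin _))
    have hr : 2 * 3 ^ (k - 1) + (τ + 1) * (2 * 3 ^ (k - 1)) =
        2 * 3 ^ (k - 1) + τ * (2 * 3 ^ (k - 1)) + 2 * 3 ^ (k - 1) := by ring
    rw [hr]
    have h := ((((ih.mono (Nat.le_add_right _ (2 * 3 ^ (k - 1)))).prodMk
      (hout.mono (by omega))).prodMk ((hcoin _).prodMk hN))).comp fun z =>
        trialStep z.1.1 (z.1.2.2 = act τ) z.2.1 (Prod.snd '' z.2.2)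
    intro G G' W W' a ha
    have himage : ∀ (G : SimpleGraph (Fin n))
        (W : Fin n → DecomposeCoin k × (Fin M → Fin (P + 1))) (D : Fin n → Option (Fin (P + 1))),
        Prod.snd '' {y : Fin n × (Option (Fin (P + 1)) × Fin (P + 1)) |
          y.1 ∈ laterNbrs G (decompose γ k pick G fun u => (W u).1) a ∧
            y.2 = (D y.1, extendSeq (W y.1).2 τ)} =
        (fun b => (D b, extendSeq (W b).2 τ)) ''
          laterNbrs G (decompose γ k pick G fun u => (W u).1) a := by
      intro G W D
      ext z
      constructor
      · rintro ⟨y, ⟨hy, hy'⟩, rfl⟩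
        exact ⟨y.1, hy, hy'.symm⟩
      · rintro ⟨b, hb, rfl⟩
        exact ⟨(b, _), ⟨hb, rfl⟩, rfl⟩
    have h' := h G G' W W' a ha
    simp only [himage] at h'
    exact h'

/-- Each set `S_i` has `r` trials. -/
theorem le_card_trials {k r i : ℕ} (hi : i ≤ k - 1) (hk : 1 ≤ k) :
    r ≤ (Finset.univ.filter fun τ : Fin (k * r) => i = k - 1 - τ / r).card := by
  rcases Nat.eq_zero_or_pos r with rfl | hr
  · exact Nat.zero_le _
  have hlt : ∀ s : Fin r, r * (k - 1 - i) + s < k * r := fun s => by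
    have h : r * (k - 1 - i) + r ≤ k * r := by
      calc r * (k - 1 - i) + r = r * (k - 1 - i + 1) := by ring
        _ ≤ r * k := Nat.mul_le_mul_left r (by omega)
        _ = k * r := Nat.mul_comm _ _
    omega
  have hcard := Finset.card_le_card_of_injOn (s := (Finset.univ : Finset (Fin r)))
    (t := Finset.univ.filter fun τ : Fin (k * r) => i = k - 1 - τ / r)
    (fun s => ⟨r * (k - 1 - i) + s, hlt s⟩) (fun s _ => ?_) (fun s _ s' _ h => ?_)
  · simpa using hcard
  · simp only [Finset.coe_filter, Finset.mem_univ, true_and, Set.mem_ofPred_eq]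
    rw [Nat.mul_add_div hr, Nat.div_eq_of_lt s.2]
    omega
  · have := congrArg Fin.val h
    exact Fin.ext (by simpa using this)

theorem exists_computesWithLabels_of_trials {c γ C : ℝ} (hc : 0 < c) (hγ : 1 ≤ γ) {k : ℕ}
    (hn : 2 ≤ n) (hk : 1 ≤ k) (pick : TieBreak n) {p : ℕ}
    (hAC : degreeBound c γ n k + 1 ≤ ⌊C * (n : ℝ) ^ (1 / (k : ℝ)) * Real.log n⌋₊)
    (hp : ⌈degreeBound c γ n k * (n : ℝ) ^ (1 / (k : ℝ))⌉₊ + 1 ≤ p) :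
    ∃ A : DistAlg n ((Fin n × ℕ) × ℕ),
      ComputesWithLabels A (2 * 3 ^ (k - 1) + k * (k * ⌈c + 2⌉₊) * (2 * 3 ^ (k - 1)) + 3 ^ (k - 1))
        c γ C k p pick := by
  have hn0 : (0 : ℝ) < n := by exact_mod_cast (by omega : 0 < n)
  have hn1 : (1 : ℝ) ≤ n := by exact_mod_cast (by omega : 1 ≤ n)
  have hq := one_le_root hn k
  have hqk := root_pow (n := n) hk
  set A := degreeBound c γ n k with hA
  set q := (n : ℝ) ^ (1 / (k : ℝ)) with hqdef
  have hq0 : 0 < q := by linarith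
  set P := ⌈A * q⌉₊ with hP
  set r := k * ⌈c + 2⌉₊ with hr
  have hact : Antitone fun τ => k - 1 - τ / r := fun τ σ h =>
    Nat.sub_le_sub_left (Nat.div_le_div_right h) _
  have hlevel : ∀ (G : SimpleGraph (Fin n)) (ω : Fin n → DecomposeCoin k) a,
      (decompose γ k pick G ω a).2 ≤ k - 1 := fun G ω a => by
    rw [decompose_eq_run]
    exact (run_snd_le _ a).trans (decomposeStop_le n γ k)
  refine exists_computesWithLabels hc hγ hn hk pick (M := k * r) (P := P)
    (fun G W a => (trialColor G (decompose γ k pick G fun u => (W u).1) (fun τ => k - 1 - τ / r)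
      (fun b => extendSeq (W b).2) (k * r) a).elim 0 Fin.val)
    (fun G ω x a => trialColor G (decompose γ k pick G ω) (fun τ => k - 1 - τ / r)
      (fun b => extendSeq (x b)) (k * r) a = none)
    (Nat.le_add_right _ _)
    ((isLocal_trialColor γ k pick _ (k * r)).comp fun y => y.elim 0 Fin.val) hAC ?_ ?_ ?_
  · intro G ω x a hle
    refine (uniformOn_trialColor_eq_none_le (fun τ => k - 1 - τ / r) (decompose γ k pick G ω) x a
      (le_card_trials (hlevel G ω a) hk) hle (ρ := q⁻¹) (by positivity)
      (inv_le_one_of_one_le₀ hq) ?_).trans (ENNReal.ofReal_le_ofReal ?_)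
    · rw [← div_eq_inv_mul, le_div_iff₀ hq0]
      have := Nat.le_ceil (A * q)
      push_cast
      linarith
    · rw [inv_pow, hr, pow_mul, hqk, ← Real.rpow_natCast, ← Real.rpow_neg hn0.le]
      exact Real.rpow_le_rpow_of_exponent_le hn1 (neg_le_neg (Nat.le_ceil _))
  · intro G W a
    refine lt_of_lt_of_le ?_ hp
    cases trialColor G (decompose γ k pick G fun u => (W u).1) (fun τ => k - 1 - τ / r)
      (fun b => extendSeq (W b).2) (k * r) a with
    | none => exact Nat.succ_pos _
    | some y => exact y.2
  · intro G W hW a b hb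
    obtain ⟨y, hy⟩ := Option.ne_none_iff_exists'.1 (hW a)
    obtain ⟨z, hz⟩ := Option.ne_none_iff_exists'.1 (hW b)
    have hne := trialColor_ne hact (decompose_leader _) hb hy hz
    simp only [hy, hz, Option.elim_some]
    exact fun h => hne (Fin.ext h)

end Trials

/-! ### The constants -/

section Main

theorem one_le_iterLog {t : ℕ} (ht : 1 ≤ t) (x : ℝ) : 1 ≤ iterLog t x := by
  obtain ⟨t, rfl⟩ : ∃ s, t = s + 1 := ⟨t - 1, by omega⟩
  exact le_max_left _ _

variable {n : ℕ} {c γ : ℝ} {k : ℕ}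

/-- A constant for which the bounds on the degree, the number of labels and the running time all
hold. -/
def mainConst (c γ : ℝ) : ℝ :=
  (c + 4) * (3 * (6 * γ + c + 4) + 4)

theorem degreeBound_le (hc : 0 < c) (hγ : 1 ≤ γ) (hn : 2 ≤ n) :
    (degreeBound c γ n k : ℝ) ≤ (6 * γ + c + 4) * ((n : ℝ) ^ (1 / (k : ℝ)) * Real.log n) := by
  have hq := one_le_root hn k
  have hL := half_lt_log hn
  rw [← mul_assoc]
  exact Nat.floor_le (by positivity)

theorem half_lt_root_mul_log (hn : 2 ≤ n) :
    1 / 2 < (n : ℝ) ^ (1 / (k : ℝ)) * Real.log n := by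
  nlinarith [one_le_root hn k, half_lt_log hn]

theorem degreeBound_add_one_le (hc : 0 < c) (hγ : 1 ≤ γ) (hn : 2 ≤ n) :
    degreeBound c γ n k + 1 ≤ ⌊mainConst c γ * (n : ℝ) ^ (1 / (k : ℝ)) * Real.log n⌋₊ := by
  have h₁ := degreeBound_le (k := k) hc hγ hn
  have h₂ := half_lt_root_mul_log (k := k) hn
  refine Nat.le_floor ?_
  push_cast
  rw [mul_assoc]
  have hC : (6 * γ + c + 4) + 2 ≤ mainConst c γ := by unfold mainConst; nlinarith
  nlinarith [mul_le_mul_of_nonneg_right hC (by linarith :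
    0 ≤ (n : ℝ) ^ (1 / (k : ℝ)) * Real.log n)]

theorem root_sq (n k : ℕ) : (n : ℝ) ^ (2 / (k : ℝ)) = ((n : ℝ) ^ (1 / (k : ℝ))) ^ 2 := by
  rw [← Real.rpow_natCast, ← Real.rpow_mul (Nat.cast_nonneg n)]
  congr 1
  push_cast
  ring

theorem list_colors_le (hc : 0 < c) (hγ : 1 ≤ γ) (hn : 2 ≤ n) {t : ℕ} (ht : 1 ≤ t) :
    ⌈(c + 2) * Real.log n⌉₊ * (3 * degreeBound c γ n k + 1) ≤
      ⌊mainConst c γ * (n : ℝ) ^ (2 / (k : ℝ)) * Real.log n ^ 2 * iterLog t n⌋₊ := by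
  have h₁ := degreeBound_le (k := k) hc hγ hn
  have h₂ := half_lt_root_mul_log (k := k) hn
  have hq := one_le_root hn k
  have hL := half_lt_log hn
  refine Nat.le_floor ?_
  rw [root_sq]
  set q := (n : ℝ) ^ (1 / (k : ℝ))
  set L := Real.log n
  have h₃ : ((⌈(c + 2) * L⌉₊ : ℕ) : ℝ) ≤ (c + 4) * L := by
    have := (Nat.ceil_lt_add_one (by positivity : 0 ≤ (c + 2) * L)).le
    linarith
  have h₄ : 3 * (degreeBound c γ n k : ℝ) + 1 ≤ (3 * (6 * γ + c + 4) + 4) * (q * L) := by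
    linarith
  have h₅ : L ≤ q * L := by nlinarith
  push_cast
  calc ((⌈(c + 2) * L⌉₊ : ℕ) : ℝ) * (3 * (degreeBound c γ n k : ℝ) + 1)
      ≤ ((c + 4) * (q * L)) * ((3 * (6 * γ + c + 4) + 4) * (q * L)) := by
        gcongr
        exact h₃.trans (by gcongr)
    _ = mainConst c γ * q ^ 2 * L ^ 2 * 1 := by
        unfold mainConst
        ring
    _ ≤ _ := by
        have := one_le_iterLog ht (n : ℝ)
        have hC : 0 ≤ mainConst c γ := by unfold mainConst; positivity
        gcongr

theorem trial_colors_le (hc : 0 < c) (hγ : 1 ≤ γ) (hn : 2 ≤ n) :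
    ⌈degreeBound c γ n k * (n : ℝ) ^ (1 / (k : ℝ))⌉₊ + 1 ≤
      ⌊mainConst c γ * (n : ℝ) ^ (2 / (k : ℝ)) * Real.log n⌋₊ := by
  have h₁ := degreeBound_le (k := k) hc hγ hn
  have hq := one_le_root hn k
  have hL := half_lt_log hn
  refine Nat.le_floor ?_
  rw [root_sq]
  set q := (n : ℝ) ^ (1 / (k : ℝ))
  set L := Real.log n
  have h₃ := (Nat.ceil_lt_add_one (by positivity : 0 ≤ (degreeBound c γ n k : ℝ) * q)).le
  have h₄ : (degreeBound c γ n k : ℝ) * q ≤ (6 * γ + c + 4) * (q * L) * q := by gcongr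
  have h₅ : 1 / 2 ≤ q ^ 2 * L := by nlinarith
  have hC : (6 * γ + c + 4) + 4 ≤ mainConst c γ := by unfold mainConst; nlinarith
  push_cast
  nlinarith [mul_le_mul_of_nonneg_right hC (by positivity : 0 ≤ q ^ 2 * L)]

end Main

theorem mainTheorem2 (c γ : ℝ) (hc : 0 < c) (hγ : 1 ≤ γ) :
    ∃ C : ℝ, 0 < C ∧ ∀ n k : ℕ, 2 ≤ n → 1 ≤ k → ∀ pick : TieBreak n,
      (∃ (T : ℕ) (A : DistAlg n (Fin n × ℕ)),
        (T : ℝ) ≤ C * 3 ^ k ∧ ComputesDecomposition A T c γ C k pick) ∧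
      (∀ t : ℕ, 1 ≤ t → ∃ (T : ℕ) (A : DistAlg n ((Fin n × ℕ) × ℕ)),
        (T : ℝ) ≤ C * 3 ^ k * t ∧
        ComputesWithLabels A T c γ C k
          ⌊C * (n : ℝ) ^ (2 / (k : ℝ)) * Real.log n ^ 2 * iterLog t n⌋₊ pick) ∧
      (∃ (T : ℕ) (A : DistAlg n ((Fin n × ℕ) × ℕ)),
        (T : ℝ) ≤ C * 3 ^ k * (k : ℝ) ^ 2 ∧
        ComputesWithLabels A T c γ C k
          ⌊C * (n : ℝ) ^ (2 / (k : ℝ)) * Real.log n⌋₊ pick) := by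
  have hC0 : 8 ≤ mainConst c γ := by unfold mainConst; nlinarith
  refine ⟨mainConst c γ, by linarith, fun n k hn hk pick => ?_⟩
  have hpow : (3 : ℝ) ^ k = 3 * 3 ^ (k - 1) := by
    rw [← pow_succ', Nat.sub_add_cancel hk]
  have hpos : (1 : ℝ) ≤ 3 ^ (k - 1) := one_le_pow₀ (by norm_num)
  have hAC := degreeBound_add_one_le (k := k) hc hγ hn
  have hk1 : (1 : ℝ) ≤ k := by exact_mod_cast hk
  refine ⟨⟨2 * 3 ^ (k - 1) + 1, gatherAlg (decomposeLaw n k) _ _, ?_, id,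
    MeasurePreserving.id _, fun G => ⟨fun ω =>
      gatherAlg_outputsWithin _ (isLocal_decompose γ k pick) G ω, ?_⟩⟩, fun t ht => ?_, ?_⟩
  · rw [hpow]
    push_cast
    nlinarith
  · refine (measure_mono fun ω hω => ?_).trans
      ((measure_not_ncard_laterNbrs_le hc hγ hn hk pick G).trans (ENNReal.ofReal_le_ofReal ?_))
    · exact fun hA => hω (isGoodDecomposition_decompose hk hA hAC)
    · exact Real.rpow_le_rpow_of_exponent_le (by exact_mod_cast (by omega : 1 ≤ n)) (by linarith)
  · obtain ⟨alg, halg⟩ := exists_computesWithLabels_of_lists hc hγ hn hk pick hAC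
      (list_colors_le (k := k) hc hγ hn ht)
    refine ⟨_, alg, ?_, halg⟩
    have ht1 : (1 : ℝ) ≤ t := by exact_mod_cast ht
    rw [hpow]
    push_cast
    calc 5 * (3 : ℝ) ^ (k - 1) ≤ mainConst c γ * (3 * 3 ^ (k - 1)) * 1 := by nlinarith
      _ ≤ _ := by gcongr
  · obtain ⟨alg, halg⟩ := exists_computesWithLabels_of_trials hc hγ hn hk pick hAC
      (trial_colors_le (k := k) hc hγ hn)
    refine ⟨_, alg, ?_, halg⟩
    have hceil := (Nat.ceil_lt_add_one (by linarith : 0 ≤ c + 2)).le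
    have hkk : (1 : ℝ) ≤ (k : ℝ) ^ 2 := one_le_pow₀ hk1
    have hC1 : c + 4 ≤ mainConst c γ := by unfold mainConst; nlinarith
    rw [hpow]
    push_cast
    calc 2 * (3 : ℝ) ^ (k - 1) + k * (k * (⌈c + 2⌉₊ : ℝ)) * (2 * 3 ^ (k - 1)) + 3 ^ (k - 1)
        = (3 + 2 * (k : ℝ) ^ 2 * (⌈c + 2⌉₊ : ℝ)) * 3 ^ (k - 1) := by ring
      _ ≤ (3 * (k : ℝ) ^ 2 + 2 * (k : ℝ) ^ 2 * (c + 2 + 1)) * 3 ^ (k - 1) := by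
          gcongr
          linarith
      _ ≤ (3 * (k : ℝ) ^ 2 * (c + 4)) * 3 ^ (k - 1) := by
          gcongr
          nlinarith
      _ = (c + 4) * (3 * 3 ^ (k - 1)) * (k : ℝ) ^ 2 := by ring
      _ ≤ _ := by gcongr

end
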